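/- Let $k$ be a field and let $H$ be a Hopf algebra over $k$ whose antipode $S$ is bijective. Write $\Delta(h)=h_1\otimes h_2$, and let $\alpha,\beta$ be Hopf algebra automorphisms of $H$. An $(\alpha,\beta)$-Yetter–Drinfeld module is a $k$-vector space $M$ that is a left $H$-module, $h\otimes m\mapsto h\cdot m$, and a right $H$-comodule, $m\mapsto m_{(0)}\otimes m_{(1)}\in M\otimes H$, such that for all $h\in H$, $m\in M$ $$(h\cdot m)_{(0)}\otimes(h\cdot m)_{(1)}=h_2\cdot m_{(0)}\otimes\beta(h_3)\,m_{(1)}\,\alpha(S^{-1}(h_1)).$$ For $\alpha=\beta=\mathrm{id}$ these are the objects of the category ${}_H\mathcal{YD}^H$ of Yetter–Drinfeld modules. An algebra in ${}_H\mathcal{YD}^H$ is a unital associative $k$-algebra $A$ with the structure of an object of ${}_H\mathcal{YD}^H$ such that $h\cdot(ab)=(h_1\cdot a)(h_2\cdot b)$, $h\cdot 1=\varepsilon(h)1$, $(ab)_{(0)}\otimes(ab)_{(1)}=a_{(0)}b_{(0)}\otimes b_{(1)}a_{(1)}$ and $1_{(0)}\otimes 1_{(1)}=1\otimes 1$. Its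 $H$-opposite $\overline{A}$ is the same object with multiplication $a*b=b_{(0)}(b_{(1)}\cdot a)$, and the braided product $A\#B$ of two algebras in ${}_H\mathcal{YD}^H$ is $A\otimes B$ with multiplication $(a\# b)(a'\# b')=aa'_{(0)}\#(a'_{(1)}\cdot b)b'$. A finite-dimensional algebra $A$ in ${}_H\mathcal{YD}^H$ is called $H$-Azumaya if both of the maps $$F:A\#\overline{A}\to \mathrm{End}_k(A),\qquad F(a\# b)(c)=a\,c_{(0)}(c_{(1)}\cdot b),$$ $$G:\overline{A}\# A\to \mathrm{End}_k(A)^{op},\qquad G(a\# b)(c)=a_{(0)}(a_{(1)}\cdot c)\,b,$$ are bijective; here all unstarred products are taken in $A$. Theorem. Let $M$ be a finite-dimensional $(\alpha,\beta)$-Yetter–Drinfeld module. Then $\mathrm{End}_k(M)$, with composition as multiplication and with the structures $$(h\cdot u)(m)=\alpha^{-1}(h_1)\cdot u\big(\alpha^{-1}(S(h_2))\cdot m\big),$$ $$u_{(0)}(m)\otimes u_{(1)}=u(m_{(0)})_{(0)}\otimes S^{-1}(m_{(1)})\,u(m_{(0)})_{(1)}$$ for $h\in H$, $u\in\mathrm{End}_k(M)$,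 $m\in M$, is an $H$-Azumaya algebra: it is a finite-dimensional algebra in ${}_H\mathcal{YD}^H$, and the maps $F$ and $G$ for $A=\mathrm{End}_k(M)$ are bijective. -/

import Mathlib

open TensorProduct Coalgebra HopfAlgebra

noncomputable section

namespace GenYD

variable {k H : Type*} [Field k] [Ring H] [HopfAlgebra k H]

/-- The operations of a left `H`-module and right `H`-comodule on a `k`-vector space `M`:
`act h m = h · m` and `coact m = m₍₀₎ ⊗ m₍₁₎`. The laws are `ModComod.IsModComod` below. -/
structure ModComod (k H M : Type*) [Field k] [Ring H] [HopfAlgebra k H]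
    [AddCommGroup M] [Module k M] where
  /-- The action `h · m`. -/
  act : H →ₗ[k] M →ₗ[k] M
  /-- The coaction `m ↦ m₍₀₎ ⊗ m₍₁₎`. -/
  coact : M →ₗ[k] M ⊗[k] H

/-- The inverse `S⁻¹` of a bijective antipode. -/
def antipodeInv (hS : Function.Bijective (antipode k (A := H))) : H →ₗ[k] H :=
  (LinearEquiv.ofBijective (antipode k (A := H)) hS).symm.toLinearMap

theorem antipodeInv_antipode (hS : Function.Bijective (antipode k (A := H))) (h : H) :
    antipodeInv hS (antipode k h) = h :=
  (LinearEquiv.ofBijective (antipode k (A := H)) hS).symm_apply_apply h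

theorem antipode_antipodeInv (hS : Function.Bijective (antipode k (A := H))) (h : H) :
    antipode k (antipodeInv hS h) = h :=
  (LinearEquiv.ofBijective (antipode k (A := H)) hS).apply_symm_apply h

section YetterDrinfeld

variable {M : Type*} [AddCommGroup M] [Module k M]

/-- `D` is a left `H`-module structure and a (coassociative, counital) right `H`-comodule
structure on `M`. -/
structure ModComod.IsModComod (D : ModComod k H M) : Prop where
  one_act : ∀ m : M, D.act 1 m = m
  mul_act : ∀ (g h : H) (m : M), D.act (g * h) m = D.act g (D.act h m)
  coact_coassoc : ∀ m : M,
    TensorProduct.assoc k M H H (D.coact.rTensor H (D.coact m)) =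
      (comul (R := k) (A := H)).lTensor M (D.coact m)
  coact_counit : ∀ m : M,
    TensorProduct.rid k M ((counit (R := k) (A := H)).lTensor M (D.coact m)) = m

/-- The map sending `h₁ ⊗ (h₂ ⊗ h₃)` to the endomorphism
`m ⊗ x ↦ h₂ · m ⊗ β(h₃) x α(S⁻¹(h₁))` of `M ⊗ H`. -/
def ydTwist (hS : Function.Bijective (antipode k (A := H))) (α β : H ≃ₐc[k] H)
    (D : ModComod k H M) : H ⊗[k] (H ⊗[k] H) →ₗ[k] Module.End k (M ⊗[k] H) :=
  TensorProduct.lift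
    (LinearMap.mk₂ k
      (fun (a : H) (t : H ⊗[k] H) =>
        ((LinearMap.mul k H).flip (α (antipodeInv hS a))).lTensor M ∘ₗ
          TensorProduct.homTensorHomMap (RingHom.id k) M H M H
            (TensorProduct.map D.act (LinearMap.mul k H ∘ₗ β.toAlgEquiv.toLinearMap) t))
      (fun a a' t => by simp only [map_add, LinearMap.lTensor_add, LinearMap.add_comp])
      (fun c a t => by simp only [map_smul, LinearMap.lTensor_smul, LinearMap.smul_comp])
      (fun a t t' => by simp only [map_add, LinearMap.comp_add])
      (fun c a t => by simp only [map_smul, LinearMap.comp_smul]))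

theorem ydTwist_tmul (hS : Function.Bijective (antipode k (A := H))) (α β : H ≃ₐc[k] H)
    (D : ModComod k H M) (a b c x : H) (m : M) :
    ydTwist hS α β D (a ⊗ₜ (b ⊗ₜ c)) (m ⊗ₜ x) =
      D.act b m ⊗ₜ (β c * x * α (antipodeInv hS a)) := by
  simp [ydTwist]

/-- `(α, β)`-Yetter-Drinfeld modules: left `H`-modules and right `H`-comodules with
`(h · m)₍₀₎ ⊗ (h · m)₍₁₎ = h₂ · m₍₀₎ ⊗ β(h₃) m₍₁₎ α(S⁻¹(h₁))`. -/
structure ModComod.IsYetterDrinfeld (hS : Function.Bijective (antipode k (A := H)))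
    (α β : H ≃ₐc[k] H) (D : ModComod k H M) : Prop extends D.IsModComod where
  compat : ∀ (h : H) (m : M),
    D.coact (D.act h m) =
      ydTwist hS α β D ((comul (R := k) (A := H)).lTensor H (comul h)) (D.coact m)

end YetterDrinfeld

section Azumaya

variable {A : Type*} [Ring A] [Algebra k A]

/-- The algebra `A` with the structures `D` is an algebra in the category of (left-right)
Yetter-Drinfeld modules, whose tensor product has the diagonal action and the coaction
`a ⊗ b ↦ (a₍₀₎ ⊗ b₍₀₎) ⊗ b₍₁₎ a₍₁₎`: unit and multiplication are `H`-linear and `H`-colinear. -/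
structure ModComod.IsYDAlgebra (hS : Function.Bijective (antipode k (A := H)))
    (D : ModComod k H A) : Prop
    extends D.IsYetterDrinfeld hS (BialgEquiv.refl k H) (BialgEquiv.refl k H) where
  act_mul : ∀ (h : H) (a b : A),
    D.act h (a * b) =
      LinearMap.mul' k A (TensorProduct.map (D.act.flip a) (D.act.flip b) (comul h))
  act_one : ∀ h : H, D.act h 1 = Coalgebra.counit (R := k) h • (1 : A)
  /-- `(a b)₍₀₎ ⊗ (a b)₍₁₎ = a₍₀₎ b₍₀₎ ⊗ b₍₁₎ a₍₁₎`, an equality in the algebra `A ⊗ Hᵒᵖ`. -/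
  coact_mul : ∀ a b : A,
    (MulOpposite.opLinearEquiv k (M := H)).toLinearMap.lTensor A (D.coact (a * b)) =
      (MulOpposite.opLinearEquiv k (M := H)).toLinearMap.lTensor A (D.coact a) *
        (MulOpposite.opLinearEquiv k (M := H)).toLinearMap.lTensor A (D.coact b)
  coact_one : D.coact 1 = 1 ⊗ₜ 1

/-- The multiplication `a * b = b₍₀₎ (b₍₁₎ · a)` of the `H`-opposite algebra of `A`. -/
def ModComod.hOpMul (D : ModComod k H A) (a b : A) : A :=
  LinearMap.mul' k A ((D.act.flip a).lTensor A (D.coact b))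

/-- The map `F(a ⊗ b)(c) = a c₍₀₎ (c₍₁₎ · b)`, on the space `A ⊗ A` underlying the braided
product of `A` with its `H`-opposite. -/
def ModComod.azumayaF (D : ModComod k H A) : A ⊗[k] A →ₗ[k] Module.End k A :=
  TensorProduct.lift
    (LinearMap.mk₂ k
      (fun a b => LinearMap.mulLeft k a ∘ₗ
        LinearMap.mul' k A ∘ₗ (D.act.flip b).lTensor A ∘ₗ D.coact)
      (fun a a' b => by ext c; simp [add_mul])
      (fun r a b => by ext c; simp)
      (fun a b b' => by ext c; simp [LinearMap.lTensor_add, mul_add])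
      (fun r a b => by ext c; simp [LinearMap.lTensor_smul]))

theorem ModComod.azumayaF_tmul (D : ModComod k H A) (a b c : A) :
    D.azumayaF (a ⊗ₜ b) c = a * D.hOpMul b c := by
  simp [ModComod.azumayaF, ModComod.hOpMul]

/-- The map `G(a ⊗ b)(c) = a₍₀₎ (a₍₁₎ · c) b`, on the space `A ⊗ A` underlying the braided
product of the `H`-opposite of `A` with `A`. The space underlying `End(A)ᵒᵖ` is `End(A)`. -/
def ModComod.azumayaG (D : ModComod k H A) : A ⊗[k] A →ₗ[k] Module.End k A :=
  TensorProduct.lift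
    (LinearMap.mk₂ k
      (fun a b => LinearMap.mulRight k b ∘ₗ
        TensorProduct.lift (LinearMap.mk₂ k
          (fun (p : A) (h : H) => LinearMap.mulLeft k p ∘ₗ D.act h)
          (fun p p' h => by ext c; simp [add_mul])
          (fun r p h => by ext c; simp)
          (fun p h h' => by ext c; simp [mul_add])
          (fun r p h => by ext c; simp)) (D.coact a))
      (fun a a' b => by ext c; simp [add_mul])
      (fun r a b => by ext c; simp)
      (fun a b b' => by ext c; simp [mul_add])
      (fun r a b => by ext c; simp))

theorem ModComod.azumayaG_tmul (D : ModComod k H A) (a b c : A) :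
    D.azumayaG (a ⊗ₜ b) c = D.hOpMul c a * b := by
  simp only [ModComod.azumayaG, ModComod.hOpMul, TensorProduct.lift.tmul,
    LinearMap.mk₂_apply, LinearMap.comp_apply, LinearMap.mulRight_apply]
  congr 1
  induction D.coact a with
  | zero => simp
  | tmul p h => simp
  | add s t hs ht => simp [hs, ht]

/-- `H`-Azumaya algebras: finite dimensional algebras in the category of Yetter-Drinfeld modules
for which both maps `F` and `G` are bijective. -/
structure ModComod.IsHAzumaya (hS : Function.Bijective (antipode k (A := H)))
    (D : ModComod k H A) : Prop where
  finiteDimensional : FiniteDimensional k A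
  isYDAlgebra : D.IsYDAlgebra hS
  bijective_F : Function.Bijective D.azumayaF
  bijective_G : Function.Bijective D.azumayaG

end Azumaya

section Endomorphisms

variable {M : Type*} [AddCommGroup M] [Module k M]

/-- `p ⊗ q ↦ (u ↦ p ∘ u ∘ q)`. -/
def sandwich (k M : Type*) [Field k] [AddCommGroup M] [Module k M] :
    Module.End k M ⊗[k] Module.End k M →ₗ[k] Module.End k (Module.End k M) :=
  TensorProduct.lift
    (LinearMap.mk₂ k
      (fun p q => LinearMap.mulLeft k p ∘ₗ LinearMap.mulRight k q)
      (fun p p' q => by ext u m; simp)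
      (fun r p q => by ext u m; simp)
      (fun p q q' => by ext u m; simp)
      (fun r p q => by ext u m; simp))

theorem sandwich_tmul (p q u : Module.End k M) (m : M) :
    sandwich k M (p ⊗ₜ q) u m = p (u (q m)) := by
  simp [sandwich]

/-- The action `(h · u)(m) = α⁻¹(h₁) · u(α⁻¹(S(h₂)) · m)` on `End(M)`. -/
def endAct (α : H ≃ₐc[k] H) (D : ModComod k H M) :
    H →ₗ[k] Module.End k M →ₗ[k] Module.End k M :=
  sandwich k M ∘ₗ
    TensorProduct.map (D.act ∘ₗ α.symm.toAlgEquiv.toLinearMap)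
      (D.act ∘ₗ α.symm.toAlgEquiv.toLinearMap ∘ₗ antipode k) ∘ₗ
    comul

/-- `(m ⊗ x) ⊗ y ↦ m ⊗ S⁻¹(y) x`. -/
def mulAntipodeInv (hS : Function.Bijective (antipode k (A := H)))
    (M : Type*) [AddCommGroup M] [Module k M] :
    (M ⊗[k] H) ⊗[k] H →ₗ[k] M ⊗[k] H :=
  (LinearMap.mul' k H ∘ₗ (antipodeInv hS).rTensor H ∘ₗ
      (TensorProduct.comm k H H).toLinearMap).lTensor M ∘ₗ
    (TensorProduct.assoc k M H H).toLinearMap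

theorem mulAntipodeInv_tmul (hS : Function.Bijective (antipode k (A := H))) (m : M) (x y : H) :
    mulAntipodeInv hS M ((m ⊗ₜ x) ⊗ₜ y) = m ⊗ₜ (antipodeInv hS y * x) := by
  simp [mulAntipodeInv]

/-- `u ↦ (m ↦ u(m₍₀₎)₍₀₎ ⊗ S⁻¹(m₍₁₎) u(m₍₀₎)₍₁₎)`. -/
def endCoactHom (hS : Function.Bijective (antipode k (A := H))) (D : ModComod k H M) :
    Module.End k M →ₗ[k] (M →ₗ[k] M ⊗[k] H) where
  toFun u := mulAntipodeInv hS M ∘ₗ (D.coact ∘ₗ u).rTensor H ∘ₗ D.coact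
  map_add' u v := by
    simp only [LinearMap.comp_add, LinearMap.rTensor_add, LinearMap.add_comp]
  map_smul' r u := by
    simp only [LinearMap.comp_smul, LinearMap.rTensor_smul, LinearMap.smul_comp,
      RingHom.id_apply]

/-- For `M` finite dimensional, the structures on `End(M)` given by
`(h · u)(m) = α⁻¹(h₁) · u(α⁻¹(S(h₂)) · m)` and
`u₍₀₎(m) ⊗ u₍₁₎ = u(m₍₀₎)₍₀₎ ⊗ S⁻¹(m₍₁₎) u(m₍₀₎)₍₁₎`. The second formula determines
`u₍₀₎ ⊗ u₍₁₎` through the canonical isomorphism `End(M) ⊗ H ≃ Hom(M, M ⊗ H)`. -/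
def endModComod [FiniteDimensional k M] (hS : Function.Bijective (antipode k (A := H)))
    (α : H ≃ₐc[k] H) (D : ModComod k H M) : ModComod k H (Module.End k M) where
  act := endAct α D
  coact := (rTensorHomEquivHomRTensor k M M H).symm.toLinearMap ∘ₗ endCoactHom hS D

theorem endModComod_coact_apply [FiniteDimensional k M]
    (hS : Function.Bijective (antipode k (A := H))) (α : H ≃ₐc[k] H) (D : ModComod k H M)
    (u : Module.End k M) (m : M) :
    TensorProduct.rTensorHomToHomRTensor (RingHom.id k) M M H ((endModComod hS α D).coact u) m =
      mulAntipodeInv hS M ((D.coact ∘ₗ u).rTensor H (D.coact m)) := by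
  rw [← rTensorHomEquivHomRTensor_apply]
  exact LinearMap.congr_fun
    ((rTensorHomEquivHomRTensor k M M H).apply_symm_apply (endCoactHom hS D u)) m

end Endomorphisms

end GenYD

end

/-! Twisting the action by `α⁻¹` turns an `(α, β)`-module into an `(id, β ∘ α⁻¹)`-module and leaves
the structures on `End(M)` unchanged, so `α = id` may be assumed. Put `A = End(M)`. The action is
then an algebra map `φ : H → A`, and finite-dimensionality turns the coaction into an element `ρ = ∑
eᵢ ⊗ tᵢ` of `A ⊗ Hᵒᵖ`, invertible with inverse `∑ eᵢ ⊗ S⁻¹(tᵢ)` because `S⁻¹` is an antipode for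
`Hᵒᵖ`.

Both structures on `A` are conjugations: the coaction is `u ↦ ρ (u ⊗ 1) ρ⁻¹`, and the action is
conjugation by `φ` in a convolution algebra. Conjugations preserve products and units, which gives
the algebra axioms. In the convolution algebra `Hom(H, A ⊗ Hᵒᵖ)` the Yetter-Drinfeld condition on
`M` reads `ρ φ = s φ ρ b`, with `s` given by `S⁻¹` and `b` by `β`. Since `b` commutes with `u ⊗ 1`,
it disappears on conjugating (`conj_eq_of_mul_eq`), and `A` is an ordinary Yetter-Drinfeld module
whatever `β` is.

For `F` and `G`, dimensions agree, so injectivity suffices. Each map factors as the injective map `p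
⊗ q ↦ (u ↦ p u q)` after explicit left-invertible maps. The only factor not inverted by the antipode
identities alone is multiplication by the Drinfeld-type element `X = ∑ eᵢ φ(S⁻¹(tᵢ))`. The rule
`φ(S²(β⁻¹(h))) X = X φ(h)` (`IsYDPair.drinfeldElt_mul`) yields an inverse of `X`. -/

noncomputable section

namespace GenYD

/-! ### Convolution algebras and conjugation in them. -/

section Convolution

variable {k C A B : Type*} [Field k] [AddCommGroup C] [Module k C] [Coalgebra k C]
  [Ring A] [Algebra k A] [Ring B] [Algebra k B]

/-- Composition with an algebra homomorphism respects convolution. -/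
def convMapHom (f : A →ₐ[k] B) : WithConv (C →ₗ[k] A) →* WithConv (C →ₗ[k] B) where
  toFun g := WithConv.toConv (f.toLinearMap ∘ₗ g.ofConv)
  map_one' := by ext c; simp
  map_mul' g h := by
    rw [LinearMap.algHom_comp_convMul_distrib]

@[simp]
theorem convMapHom_apply (f : A →ₐ[k] B) (g : WithConv (C →ₗ[k] A)) (c : C) :
    convMapHom f g c = f (g c) := rfl

/-- The element `a` of `A` as the map `c ↦ ε(c) a`. -/
def convConst (a : A) : WithConv (C →ₗ[k] A) :=
  WithConv.toConv (LinearMap.toSpanSingleton k A a ∘ₗ counit)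

theorem convConst_apply (a : A) (c : C) :
    (convConst a : WithConv (C →ₗ[k] A)) c = counit (R := k) c • a := rfl

theorem convConst_mul_apply (a : A) (f : WithConv (C →ₗ[k] A)) (c : C) :
    (convConst a * f : WithConv (C →ₗ[k] A)) c = a * f c := by
  have h := congrArg (LinearMap.mulLeft k a ∘ₗ f.ofConv ∘ₗ (TensorProduct.lid k C).toLinearMap)
    (rTensor_counit_comul (R := k) c)
  simp only [LinearMap.comp_apply, LinearEquiv.coe_coe, TensorProduct.lid_tmul, one_smul,
    LinearMap.mulLeft_apply] at h
  rw [← h, LinearMap.convMul_apply]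
  induction comul (R := k) c with
  | zero => simp
  | tmul x y => simp [convConst]
  | add x y hx hy => simp only [map_add, mul_add, hx, hy]

theorem mul_convConst_apply (a : A) (f : WithConv (C →ₗ[k] A)) (c : C) :
    (f * convConst a : WithConv (C →ₗ[k] A)) c = f c * a := by
  have h := congrArg (LinearMap.mulRight k a ∘ₗ f.ofConv ∘ₗ (TensorProduct.rid k C).toLinearMap)
    (lTensor_counit_comul (R := k) c)
  simp only [LinearMap.comp_apply, LinearEquiv.coe_coe, TensorProduct.rid_tmul, one_smul,
    LinearMap.mulRight_apply] at h
  rw [← h, LinearMap.convMul_apply]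
  induction comul (R := k) c with
  | zero => simp
  | tmul x y => simp [convConst]
  | add x y hx hy => simp only [map_add, add_mul, hx, hy]

theorem convConst_mul (a b : A) :
    (convConst (a * b) : WithConv (C →ₗ[k] A)) = convConst a * convConst b := by
  ext c
  change (convConst (a * b) : WithConv (C →ₗ[k] A)) c =
    (convConst a * convConst b : WithConv (C →ₗ[k] A)) c
  rw [convConst_mul_apply, convConst_apply, convConst_apply, mul_smul_comm]

theorem convConst_one : (convConst 1 : WithConv (C →ₗ[k] A)) = 1 := by
  ext c
  change (convConst 1 : WithConv (C →ₗ[k] A)) c = (1 : WithConv (C →ₗ[k] A)) c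
  rw [convConst_apply, LinearMap.convOne_apply, Algebra.algebraMap_eq_smul_one]

/-- Brings a triple convolution into the shape `h₁ ⊗ (h₂ ⊗ h₃)` on which `ydTwist` is defined. -/
theorem convMul_convMul_apply (f g h : WithConv (C →ₗ[k] A)) (c : C) :
    (f * (g * h)) c = LinearMap.mul' k A (TensorProduct.map f.ofConv
      (LinearMap.mul' k A ∘ₗ TensorProduct.map g.ofConv h.ofConv)
      ((comul (R := k) (A := C)).lTensor C (comul c))) := by
  rw [LinearMap.convMul_apply]
  change LinearMap.mul' k A (TensorProduct.map f.ofConv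
    ((LinearMap.mul' k A ∘ₗ TensorProduct.map g.ofConv h.ofConv) ∘ₗ comul) (comul c)) = _
  rw [← LinearMap.map_comp_lTensor]
  rfl

theorem mul_eq_of_eq_mul_of_mul_eq_one {G : Type*} [Monoid G] {a b x y : G} (h : x = a * y)
    (hb : b * a = 1) : b * x = y := by
  rw [h, ← mul_assoc, hb, one_mul]

/-- Conjugating `u` by `ρ φ` rewrites according to a commutation rule for `ρ φ`. -/
theorem conj_eq_of_mul_eq {G : Type*} [Monoid G] (ρ φ s b : Gˣ) (u : G)
    (h : ρ * φ = s * φ * ρ * b) (hu : (b : G) * u = u * b) :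
    ρ * (φ * u * (φ⁻¹ : Gˣ)) * (ρ⁻¹ : Gˣ) =
      s * (φ * (ρ * u * (ρ⁻¹ : Gˣ)) * (φ⁻¹ : Gˣ) * (s⁻¹ : Gˣ)) := by
  have h' : φ⁻¹ * ρ⁻¹ = b⁻¹ * ρ⁻¹ * φ⁻¹ * s⁻¹ := by
    rw [← mul_inv_rev, h]; group
  have h1 : (ρ : G) * φ = s * φ * ρ * b := by exact_mod_cast congrArg Units.val h
  have h2 : ((φ⁻¹ : Gˣ) : G) * (ρ⁻¹ : Gˣ) =
      (b⁻¹ : Gˣ) * (ρ⁻¹ : Gˣ) * (φ⁻¹ : Gˣ) * (s⁻¹ : Gˣ) := by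
    exact_mod_cast congrArg Units.val h'
  rw [← mul_assoc, ← mul_assoc, mul_assoc _ ((φ⁻¹ : Gˣ) : G), h2, h1]
  -- This is where the automorphism `β` drops out of the compatibility condition for `End(M)`.
  have h3 : (b : G) * u * (b⁻¹ : Gˣ) = u := by rw [hu, Units.mul_inv_cancel_right]
  calc _ = (s : G) * (φ * (ρ * ((b : G) * u * (b⁻¹ : Gˣ)) * (ρ⁻¹ : Gˣ)) * (φ⁻¹ : Gˣ) *
      (s⁻¹ : Gˣ)) := by simp only [mul_assoc]
    _ = _ := by rw [h3]

end Convolution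

/-! ### Identities for the antipode and its inverse. -/

section Antipode

variable {k H : Type*} [Field k] [Ring H] [HopfAlgebra k H]

theorem convMapHom_mul_antipode {A : Type*} [Ring A] [Algebra k A] (f : H →ₐ[k] A) :
    convMapHom f (WithConv.toConv LinearMap.id) * convMapHom f (WithConv.toConv (antipode k)) = 1 := by
  rw [← map_mul, LinearMap.id_mul_antipode, map_one]

theorem convMapHom_antipode_mul {A : Type*} [Ring A] [Algebra k A] (f : H →ₐ[k] A) :
    convMapHom f (WithConv.toConv (antipode k)) * convMapHom f (WithConv.toConv LinearMap.id) = 1 := by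
  rw [← map_mul, LinearMap.antipode_mul_id, map_one]

/-- Both sides are convolution inverses of `Δ` in `Hom(H, H ⊗ H)`. -/
theorem comul_antipode (h : H) :
    comul (R := k) (antipode k h) =
      TensorProduct.map (antipode k) (antipode k) (TensorProduct.comm k H H (comul h)) := by
  let l : H →ₐ[k] H ⊗[k] H := Algebra.TensorProduct.includeLeft
  let r : H →ₐ[k] H ⊗[k] H := Algebra.TensorProduct.includeRight
  let i : WithConv (H →ₗ[k] H) := WithConv.toConv LinearMap.id
  let s : WithConv (H →ₗ[k] H) := WithConv.toConv (antipode k)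
  -- `Δ` is the convolution product of `h ↦ h ⊗ 1` and `h ↦ 1 ⊗ h`, so a left inverse is the product
  -- of their inverses in reverse order.
  have hδ : WithConv.toConv comul = convMapHom l i * convMapHom r i := by
    ext x
    rw [LinearMap.convMul_def]
    change comul x = LinearMap.mul' k _ (TensorProduct.map _ _ (comul x))
    induction comul (R := k) x with
    | zero => simp
    | tmul a b => simp [convMapHom, l, r, i]
    | add a b ha hb => rw [map_add, map_add, ← ha, ← hb]
  have hG : WithConv.toConv (TensorProduct.map (antipode k) (antipode k) ∘ₗ
      (TensorProduct.comm k H H).toLinearMap ∘ₗ comul) = convMapHom r s * convMapHom l s := by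
    ext x
    rw [LinearMap.convMul_def]
    change TensorProduct.map _ _ (TensorProduct.comm k H H (comul x)) =
      LinearMap.mul' k _ (TensorProduct.map _ _ (comul x))
    induction comul (R := k) x with
    | zero => simp
    | tmul a b => simp [convMapHom, l, r, s]
    | add a b ha hb => simp only [map_add, ha, hb]
  have h2 : (convMapHom r s * convMapHom l s) * WithConv.toConv comul = 1 := by
    rw [hδ, mul_assoc, ← mul_assoc (convMapHom l s), convMapHom_antipode_mul, one_mul,
      convMapHom_antipode_mul]
  have h3 := left_inv_eq_right_inv h2 LinearMap.comul_right_inv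
  rw [← hG] at h3
  exact (LinearMap.congr_fun (congrArg WithConv.ofConv h3) h).symm

/-- Both `α ∘ S` and `S ∘ α` are convolution inverses of `α`. -/
theorem map_antipode_of_bialgEquiv (α : H ≃ₐc[k] H) (h : H) :
    α (antipode k h) = antipode k (α h) := by
  let s : WithConv (H →ₗ[k] H) := WithConv.toConv (antipode k)
  let f : H →ₐ[k] H := α.toAlgEquiv.toAlgHom
  have h1 : convMapHom f s * WithConv.toConv f.toLinearMap = 1 := convMapHom_antipode_mul f
  have h2 : WithConv.toConv f.toLinearMap * WithConv.toConv (antipode k ∘ₗ f.toLinearMap) = 1 := by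
    have e := LinearMap.convMul_comp_coalgHom_distrib (R := k) (WithConv.toConv LinearMap.id)
      (WithConv.toConv (antipode k (A := H))) (α.toCoalgEquiv.toCoalgHom)
    rw [LinearMap.id_mul_antipode] at e
    refine WithConv.ofConv_injective (e.symm.trans ?_)
    ext x
    change algebraMap k H (counit (α x)) = algebraMap k H (counit x)
    rw [CoalgHomClass.counit_comp_apply]
  exact LinearMap.congr_fun (congrArg WithConv.ofConv (left_inv_eq_right_inv h1 h2)) h

variable (hS : Function.Bijective (antipode k (A := H)))

theorem antipodeInv_mul (x y : H) :
    antipodeInv hS (x * y) = antipodeInv hS y * antipodeInv hS x := by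
  apply hS.1
  rw [antipode_mul_antidistrib, antipode_antipodeInv, antipode_antipodeInv, antipode_antipodeInv]

theorem counit_antipodeInv (x : H) : counit (R := k) (antipodeInv hS x) = counit (R := k) x := by
  rw [← counit_antipode, antipode_antipodeInv]

theorem map_antipodeInv_of_bialgEquiv (α : H ≃ₐc[k] H) (h : H) :
    α (antipodeInv hS h) = antipodeInv hS (α h) := by
  apply hS.1
  rw [antipode_antipodeInv, ← map_antipode_of_bialgEquiv, antipode_antipodeInv]

theorem comul_antipodeInv (h : H) :
    comul (R := k) (antipodeInv hS h) =
      TensorProduct.map (antipodeInv hS) (antipodeInv hS) (TensorProduct.comm k H H (comul h)) := by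
  have key : ∀ z : H ⊗[k] H, TensorProduct.map (antipodeInv hS) (antipodeInv hS)
      (TensorProduct.comm k H H (TensorProduct.map (antipode k) (antipode k)
        (TensorProduct.comm k H H z))) = z := by
    intro z
    induction z with
    | zero => simp
    | tmul a b => simp [antipodeInv_antipode]
    | add a b ha hb => simp only [map_add, ha, hb]
  conv_rhs => rw [← antipode_antipodeInv hS h, comul_antipode, key]

/-- `S⁻¹(h₂) h₁ = ε(h)`. -/
theorem mul_antipodeInv_comul (h : H) :
    LinearMap.mul' k H ((antipodeInv hS).rTensor H (TensorProduct.comm k H H (comul h))) =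
      algebraMap k H (counit h) := by
  apply hS.1
  rw [Algebra.algebraMap_eq_smul_one, map_smul, antipode_one, ← Algebra.algebraMap_eq_smul_one,
    ← mul_antipode_rTensor_comul_apply]
  induction comul (R := k) h with
  | zero => simp
  | tmul a b => simp [antipode_mul_antidistrib, antipode_antipodeInv]
  | add a b ha hb => simp only [map_add, ha, hb]

/-- `h₂ S⁻¹(h₁) = ε(h)`. -/
theorem mul_comul_antipodeInv (h : H) :
    LinearMap.mul' k H ((antipodeInv hS).lTensor H (TensorProduct.comm k H H (comul h))) =
      algebraMap k H (counit h) := by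
  apply hS.1
  rw [Algebra.algebraMap_eq_smul_one, map_smul, antipode_one, ← Algebra.algebraMap_eq_smul_one,
    ← mul_antipode_lTensor_comul_apply]
  induction comul (R := k) h with
  | zero => simp
  | tmul a b => simp [antipode_mul_antidistrib, antipode_antipodeInv]
  | add a b ha hb => simp only [map_add, ha, hb]

end Antipode

/-! ### Corepresentations as units of `A ⊗ Hᵒᵖ`, and the Yetter-Drinfeld relation. -/

section Corepresentation

variable {k H A ι : Type*} [Field k] [Ring H] [HopfAlgebra k H] [Ring A] [Algebra k A] [Fintype ι]

/-- The element `∑ eᵢ ⊗ tᵢ` of `A ⊗ H` is a corepresentation: for `A = End(M)` this says that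
`m ↦ ∑ eᵢ(m) ⊗ tᵢ` is a right coaction on `M`. -/
structure IsCorep (k : Type*) {H A ι : Type*} [Field k] [Ring H] [HopfAlgebra k H] [Ring A]
    [Algebra k A] [Fintype ι] (e : ι → A) (t : ι → H) : Prop where
  sum_comul : ∑ i, e i ⊗ₜ[k] comul (R := k) (t i) = ∑ i, ∑ j, (e j * e i) ⊗ₜ[k] (t j ⊗ₜ[k] t i)
  sum_counit : ∑ i, counit (R := k) (t i) • e i = 1

namespace IsCorep

variable {e : ι → A} {t : ι → H}

theorem sum_counit_tmul (he : IsCorep k e t) : ∑ i, e i ⊗ₜ[k] algebraMap k H (counit (t i)) =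
    1 ⊗ₜ 1 := by
  simp_rw [Algebra.algebraMap_eq_smul_one, TensorProduct.tmul_smul, TensorProduct.smul_tmul']
  rw [← TensorProduct.sum_tmul, he.sum_counit]

/-- Transfers each antipode identity in `H` to an inversion formula for `∑ eᵢ ⊗ tᵢ`, by applying `L`
to the comultiplication rule. -/
theorem sum_mul_tmul (he : IsCorep k e t) (L : H ⊗[k] H →ₗ[k] H)
    (hL : ∀ h : H, L (comul h) = algebraMap k H (counit h)) :
    ∑ i, ∑ j, (e j * e i) ⊗ₜ[k] L (t j ⊗ₜ t i) = 1 ⊗ₜ 1 := by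
  have h := congrArg (L.lTensor A) he.sum_comul
  simp only [map_sum, LinearMap.lTensor_tmul, hL, he.sum_counit_tmul] at h
  exact h.symm

theorem sum_mul_tmul_mul_antipode (he : IsCorep k e t) :
    ∑ i, ∑ j, (e j * e i) ⊗ₜ[k] (t j * antipode k (t i)) = 1 ⊗ₜ 1 := by
  simpa using he.sum_mul_tmul (LinearMap.mul' k H ∘ₗ (antipode k).lTensor H)
    (fun h => by simp)

theorem sum_mul_tmul_antipodeInv_mul (he : IsCorep k e t)
    (hS : Function.Bijective (antipode k (A := H))) :
    ∑ i, ∑ j, (e j * e i) ⊗ₜ[k] (antipodeInv hS (t i) * t j) = 1 ⊗ₜ 1 := by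
  simpa using he.sum_mul_tmul (LinearMap.mul' k H ∘ₗ (antipodeInv hS).rTensor H ∘ₗ
    (TensorProduct.comm k H H).toLinearMap) (mul_antipodeInv_comul hS)

theorem sum_mul_tmul_mul_antipodeInv (he : IsCorep k e t)
    (hS : Function.Bijective (antipode k (A := H))) :
    ∑ i, ∑ j, (e j * e i) ⊗ₜ[k] (t i * antipodeInv hS (t j)) = 1 ⊗ₜ 1 := by
  simpa using he.sum_mul_tmul (LinearMap.mul' k H ∘ₗ (antipodeInv hS).lTensor H ∘ₗ
    (TensorProduct.comm k H H).toLinearMap) (mul_comul_antipodeInv hS)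

end IsCorep

/-- The element `∑ eᵢ ⊗ tᵢ` of `A ⊗ Hᵒᵖ`. -/
def corepElt (k : Type*) {H A ι : Type*} [Field k] [Ring H] [HopfAlgebra k H] [Ring A]
    [Algebra k A] [Fintype ι] (e : ι → A) (t : ι → H) : A ⊗[k] Hᵐᵒᵖ :=
  ∑ i, e i ⊗ₜ MulOpposite.op (t i)

/-- The unit of `A ⊗ Hᵒᵖ` given by a corepresentation, with inverse `∑ eᵢ ⊗ S⁻¹(tᵢ)`. -/
def IsCorep.unit {e : ι → A} {t : ι → H} (he : IsCorep k e t)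
    (hS : Function.Bijective (antipode k (A := H))) : (A ⊗[k] Hᵐᵒᵖ)ˣ where
  val := corepElt k e t
  inv := corepElt k e (fun i => antipodeInv hS (t i))
  val_inv := by
    have h := congrArg ((MulOpposite.opLinearEquiv k (M := H)).toLinearMap.lTensor A)
      (he.sum_mul_tmul_antipodeInv_mul hS)
    simpa only [corepElt, Finset.sum_mul, Finset.mul_sum, map_sum, LinearMap.lTensor_tmul,
      Algebra.TensorProduct.tmul_mul_tmul, LinearEquiv.coe_coe, MulOpposite.coe_opLinearEquiv,
      MulOpposite.op_mul, MulOpposite.op_one,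
      Algebra.TensorProduct.one_def] using h
  inv_val := by
    have h := congrArg ((MulOpposite.opLinearEquiv k (M := H)).toLinearMap.lTensor A)
      (he.sum_mul_tmul_mul_antipodeInv hS)
    simpa only [corepElt, Finset.sum_mul, Finset.mul_sum, map_sum, LinearMap.lTensor_tmul,
      Algebra.TensorProduct.tmul_mul_tmul, LinearEquiv.coe_coe, MulOpposite.coe_opLinearEquiv,
      MulOpposite.op_mul, MulOpposite.op_one,
      Algebra.TensorProduct.one_def] using h

/-- `h ↦ 1 ⊗ f(h)` with values in `A ⊗ Hᵒᵖ`. -/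
def convOp (A : Type*) [Ring A] [Algebra k A] (f : H →ₗ[k] H) :
    WithConv (H →ₗ[k] A ⊗[k] Hᵐᵒᵖ) :=
  WithConv.toConv (TensorProduct.mk k A Hᵐᵒᵖ 1 ∘ₗ
    (MulOpposite.opLinearEquiv k (M := H)).toLinearMap ∘ₗ f)

@[simp]
theorem convOp_apply (f : H →ₗ[k] H) (h : H) :
    convOp A f h = 1 ⊗ₜ MulOpposite.op (f h) := rfl

/-- `h ↦ f(h) ⊗ 1` with values in `A ⊗ Hᵒᵖ`. -/
def convLeft (f : H →ₗ[k] A) : WithConv (H →ₗ[k] A ⊗[k] Hᵐᵒᵖ) :=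
  convMapHom Algebra.TensorProduct.includeLeft (WithConv.toConv f)

@[simp]
theorem convLeft_apply (f : H →ₗ[k] A) (h : H) : convLeft f h = f h ⊗ₜ 1 := rfl

theorem convOp_mul_convOp (f g : H →ₗ[k] H) (h : H) :
    (convOp A f * convOp A g : WithConv (H →ₗ[k] A ⊗[k] Hᵐᵒᵖ)) h =
      1 ⊗ₜ MulOpposite.op (LinearMap.mul' k H (TensorProduct.map g f
        (TensorProduct.comm k H H (comul h)))) := by
  rw [LinearMap.convMul_apply]
  induction comul (R := k) h with
  | zero => simp
  | tmul x y => simp [convOp]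
  | add x y hx hy => simp only [map_add, hx, hy, MulOpposite.op_add, TensorProduct.tmul_add]

theorem convOp_mul_convOp_eq_one (f g : H →ₗ[k] H) (hfg : ∀ h : H,
      LinearMap.mul' k H (TensorProduct.map g f (TensorProduct.comm k H H (comul h))) =
      algebraMap k H (counit h)) : convOp A f * convOp A g = 1 := by
  ext h
  change (convOp A f * convOp A g : WithConv (H →ₗ[k] A ⊗[k] Hᵐᵒᵖ)) h =
    (1 : WithConv (H →ₗ[k] A ⊗[k] Hᵐᵒᵖ)) h
  rw [convOp_mul_convOp, hfg, LinearMap.convOne_apply, Algebra.algebraMap_eq_smul_one,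
    Algebra.algebraMap_eq_smul_one, MulOpposite.op_smul, MulOpposite.op_one,
    TensorProduct.tmul_smul, Algebra.TensorProduct.one_def]

/-- `h ↦ 1 ⊗ f(h)` is convolution invertible in `A ⊗ Hᵒᵖ`, with inverse `h ↦ 1 ⊗ f(S⁻¹(h))`. -/
def convOpUnit (A : Type*) [Ring A] [Algebra k A] (hS : Function.Bijective (antipode k (A := H)))
    (f : H →ₐ[k] H) : (WithConv (H →ₗ[k] A ⊗[k] Hᵐᵒᵖ))ˣ where
  val := convOp A f.toLinearMap
  inv := convOp A (f.toLinearMap ∘ₗ antipodeInv hS)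
  val_inv := by
    refine convOp_mul_convOp_eq_one _ _ fun h => ?_
    have := congrArg f (mul_antipodeInv_comul hS h)
    rw [AlgHom.commutes] at this
    rw [← this]
    induction comul (R := k) h with
    | zero => simp
    | tmul x y => simp
    | add x y hx hy => simp only [map_add, hx, hy]
  inv_val := by
    refine convOp_mul_convOp_eq_one _ _ fun h => ?_
    have := congrArg f (mul_comul_antipodeInv hS h)
    rw [AlgHom.commutes] at this
    rw [← this]
    induction comul (R := k) h with
    | zero => simp
    | tmul x y => simp
    | add x y hx hy => simp only [map_add, hx, hy]

/-- `h ↦ φ(h) ⊗ 1` is convolution invertible, with inverse `h ↦ φ(S(h)) ⊗ 1`. -/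
def convLeftUnit (φ : H →ₐ[k] A) : (WithConv (H →ₗ[k] A ⊗[k] Hᵐᵒᵖ))ˣ where
  val := convLeft φ.toLinearMap
  inv := convLeft (φ.toLinearMap ∘ₗ antipode k)
  val_inv := convMapHom_mul_antipode (Algebra.TensorProduct.includeLeft.comp φ)
  inv_val := convMapHom_antipode_mul (Algebra.TensorProduct.includeLeft.comp φ)

/-- Constants that are units are convolution invertible. -/
def convConstUnit {C B : Type*} [AddCommGroup C] [Module k C] [Coalgebra k C] [Ring B]
    [Algebra k B] (u : Bˣ) : (WithConv (C →ₗ[k] B))ˣ where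
  val := convConst (u : B)
  inv := convConst ((u⁻¹ : Bˣ) : B)
  val_inv := by rw [← convConst_mul, Units.mul_inv, convConst_one]
  inv_val := by rw [← convConst_mul, Units.inv_mul, convConst_one]

/-- The compatibility of an algebra map `φ : H → A` with `∑ eᵢ ⊗ tᵢ`: for `A = End(M)` this is
the condition on `M` to be a `(id, β)`-Yetter-Drinfeld module. -/
def IsYDPair (hS : Function.Bijective (antipode k (A := H))) (β : H ≃ₐc[k] H) (φ : H →ₐ[k] A)
    (e : ι → A) (t : ι → H) : Prop :=
  convConst (corepElt k e t) * convLeft φ.toLinearMap =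
    convOp A (antipodeInv hS) * (convLeft φ.toLinearMap * (convConst (corepElt k e t) *
      convOp A β.toAlgEquiv.toLinearMap))

/-- The Yetter-Drinfeld compatibility of `End(M)` in convolution form: coacting on `h · u` on the
left, twisting the coaction of `u` on the right. -/
theorem IsYDPair.conj {hS : Function.Bijective (antipode k (A := H))} {β : H ≃ₐc[k] H}
    {φ : H →ₐ[k] A} {e : ι → A} {t : ι → H} (hφ : IsYDPair hS β φ e t) (he : IsCorep k e t)
    (u : A) :
    convConst (corepElt k e t) * (convLeft φ.toLinearMap * convConst (u ⊗ₜ 1) *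
      convLeft (φ.toLinearMap ∘ₗ antipode k)) *
        convConst (corepElt k e fun i => antipodeInv hS (t i)) =
    convOp A (antipodeInv hS) * (convLeft φ.toLinearMap * convConst (corepElt k e t * (u ⊗ₜ 1) *
      corepElt k e fun i => antipodeInv hS (t i)) *
        convLeft (φ.toLinearMap ∘ₗ antipode k) * convOp A LinearMap.id) := by
  have key := conj_eq_of_mul_eq (convConstUnit (he.unit hS)) (convLeftUnit φ)
    (convOpUnit A hS (AlgHom.id k H))⁻¹ (convOpUnit A hS β.toAlgEquiv.toAlgHom)
    (convConst (u ⊗ₜ 1)) (Units.ext (by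
      simp only [Units.val_mul, mul_assoc]
      exact hφ)) (by
      ext h
      change (convOp A β.toAlgEquiv.toLinearMap * convConst (u ⊗ₜ[k] 1) :
        WithConv (H →ₗ[k] A ⊗[k] Hᵐᵒᵖ)) h = (convConst (u ⊗ₜ[k] 1) *
          convOp A β.toAlgEquiv.toLinearMap : WithConv (H →ₗ[k] A ⊗[k] Hᵐᵒᵖ)) h
      rw [mul_convConst_apply, convConst_mul_apply, convOp_apply]
      simp)
  rw [convConst_mul, convConst_mul]
  exact key

end Corepresentation

/-! ### The Drinfeld-type element and its inverse. -/

section Azumaya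

variable {k H A ι : Type*} [Field k] [Ring H] [HopfAlgebra k H] [Ring A] [Algebra k A] [Fintype ι]

/-- The element `∑ eᵢ φ(S⁻¹(tᵢ))`, an analogue of the Drinfeld element. -/
def drinfeldElt (hS : Function.Bijective (antipode k (A := H))) (φ : H →ₐ[k] A) (e : ι → A)
    (t : ι → H) : A :=
  ∑ i, e i * φ (antipodeInv hS (t i))

/-- Moving `S⁻¹(h₁)` to the other side of the Yetter-Drinfeld relation and collapsing `a ⊗ x` to `a
φ(S⁻¹(x))` gives, with `X` the Drinfeld-type element, `φ(h₁) X φ(S⁻¹(β(h₂))) = ε(h) X`. -/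
theorem IsYDPair.sum_mul_drinfeldElt {hS : Function.Bijective (antipode k (A := H))}
    {β : H ≃ₐc[k] H} {φ : H →ₐ[k] A} {e : ι → A} {t : ι → H} (hφ : IsYDPair hS β φ e t) :
    convMapHom φ (WithConv.toConv LinearMap.id) * (convConst (drinfeldElt hS φ e t) *
      WithConv.toConv (φ.toLinearMap ∘ₗ antipodeInv hS ∘ₗ β.toAlgEquiv.toLinearMap)) =
    (convConst (drinfeldElt hS φ e t) : WithConv (H →ₗ[k] A)) := by
  have h1 : convOp A LinearMap.id * (convConst (corepElt k e t) * convLeft φ.toLinearMap) =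
      convLeft φ.toLinearMap * (convConst (corepElt k e t) *
        convOp A β.toAlgEquiv.toLinearMap) :=
    mul_eq_of_eq_mul_of_mul_eq_one hφ (convOpUnit A hS (AlgHom.id k H)).mul_inv
  -- The collapsing map `a ⊗ x ↦ a φ(S⁻¹(x))`, which sends `∑ eᵢ ⊗ tᵢ` to the Drinfeld-type element.
  let χ : A ⊗[k] Hᵐᵒᵖ →ₗ[k] A := LinearMap.mul' k A ∘ₗ (φ.toLinearMap ∘ₗ antipodeInv hS ∘ₗ
    (MulOpposite.opLinearEquiv k (M := H)).symm.toLinearMap).lTensor A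
  ext h
  have h3 := congrArg (fun f : WithConv (H →ₗ[k] A ⊗[k] Hᵐᵒᵖ) => χ (f h)) h1
  simp only [LinearMap.convMul_apply] at h3
  have hL : ∀ z : H ⊗[k] H, χ (LinearMap.mul' k _ (TensorProduct.map (convOp A LinearMap.id).ofConv
      (convConst (corepElt k e t) * convLeft φ.toLinearMap :
        WithConv (H →ₗ[k] A ⊗[k] Hᵐᵒᵖ)).ofConv z)) =
      ∑ i, e i * φ (LinearMap.mul' k H ((antipodeInv hS).lTensor H (TensorProduct.comm k H H z))) *
        φ (antipodeInv hS (t i)) := by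
    intro z
    induction z with
    | zero => simp
    | tmul x y =>
      rw [TensorProduct.map_tmul, LinearMap.mul'_apply, convConst_mul_apply, corepElt]
      simp [χ, Finset.sum_mul, Finset.mul_sum, antipodeInv_mul, mul_assoc]
    | add x y hx hy => simp only [map_add, hx, hy, mul_add, add_mul, Finset.sum_add_distrib]
  have hR : ∀ z : H ⊗[k] H, χ (LinearMap.mul' k _ (TensorProduct.map (convLeft φ.toLinearMap).ofConv
      (convConst (corepElt k e t) * convOp A β.toAlgEquiv.toLinearMap :
        WithConv (H →ₗ[k] A ⊗[k] Hᵐᵒᵖ)).ofConv z)) =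
      LinearMap.mul' k _ (TensorProduct.map (convMapHom φ (WithConv.toConv LinearMap.id)).ofConv
        (convConst (drinfeldElt hS φ e t) * WithConv.toConv (φ.toLinearMap ∘ₗ antipodeInv hS ∘ₗ
          β.toAlgEquiv.toLinearMap) : WithConv (H →ₗ[k] A)).ofConv z) := by
    intro z
    induction z with
    | zero => simp
    | tmul x y =>
      rw [TensorProduct.map_tmul, TensorProduct.map_tmul, LinearMap.mul'_apply,
        LinearMap.mul'_apply, convConst_mul_apply, convConst_mul_apply, corepElt, drinfeldElt]
      simp [χ, Finset.sum_mul, Finset.mul_sum, antipodeInv_mul, mul_assoc]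
    | add x y hx hy => simp only [map_add, hx, hy]
  rw [hL, hR, mul_comul_antipodeInv] at h3
  change (_ * _ : WithConv (H →ₗ[k] A)) h = (convConst (drinfeldElt hS φ e t) :
    WithConv (H →ₗ[k] A)) h
  rw [LinearMap.convMul_apply, ← h3, convConst_apply, drinfeldElt, Finset.smul_sum]
  refine Finset.sum_congr rfl fun i _ => ?_
  rw [AlgHom.commutes, Algebra.algebraMap_eq_smul_one, mul_smul_comm, mul_one, smul_mul_assoc]

/-- Cancelling `φ(h₁)` in the preceding identity leaves `X φ(S⁻¹(β(h))) = φ(S(h)) X`; evaluate it at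
`S(β⁻¹(h))`. -/
theorem IsYDPair.drinfeldElt_mul {hS : Function.Bijective (antipode k (A := H))}
    {β : H ≃ₐc[k] H} {φ : H →ₐ[k] A} {e : ι → A} {t : ι → H} (hφ : IsYDPair hS β φ e t) (h : H) :
    φ (antipode k (antipode k (β.symm h))) * drinfeldElt hS φ e t =
      drinfeldElt hS φ e t * φ h := by
  have h1 : (convConst (drinfeldElt hS φ e t) *
      WithConv.toConv (φ.toLinearMap ∘ₗ antipodeInv hS ∘ₗ β.toAlgEquiv.toLinearMap) :
        WithConv (H →ₗ[k] A)) = convMapHom φ (WithConv.toConv (antipode k)) *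
          convConst (drinfeldElt hS φ e t) :=
    (mul_eq_of_eq_mul_of_mul_eq_one hφ.sum_mul_drinfeldElt.symm (convMapHom_antipode_mul φ)).symm
  have h2 : drinfeldElt hS φ e t * φ (antipodeInv hS (β (antipode k (β.symm h)))) =
      φ (antipode k (antipode k (β.symm h))) * drinfeldElt hS φ e t := by
    have h3 := LinearMap.congr_fun (congrArg WithConv.ofConv h1) (antipode k (β.symm h))
    rw [convConst_mul_apply, mul_convConst_apply] at h3
    exact h3
  rw [← h2, map_antipode_of_bialgEquiv, antipodeInv_antipode, BialgEquiv.apply_symm_apply]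

theorem IsYDPair.exists_mul_drinfeldElt_eq_one {hS : Function.Bijective (antipode k (A := H))}
    {β : H ≃ₐc[k] H} {φ : H →ₐ[k] A} {e : ι → A} {t : ι → H} (hφ : IsYDPair hS β φ e t)
    (he : IsCorep k e t) : ∃ y : A, y * drinfeldElt hS φ e t = 1 := by
  -- Chosen so that the commutation rule moves `φ` past `X`: the product becomes `∑ eⱼ X φ(tⱼ) = ∑
  -- eⱼ eᵢ φ(S⁻¹(tᵢ) tⱼ) = 1`.
  refine ⟨∑ j, e j * φ (antipode k (antipode k (β.symm (t j)))), ?_⟩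
  have h := congrArg (LinearMap.mul' k A ∘ₗ φ.toLinearMap.lTensor A)
    (he.sum_mul_tmul_antipodeInv_mul hS)
  rw [Finset.sum_comm] at h
  simp only [map_sum, LinearMap.comp_apply, LinearMap.lTensor_tmul, LinearMap.mul'_apply,
    AlgHom.toLinearMap_apply, map_one, mul_one, map_mul] at h
  rw [← h, Finset.sum_mul]
  refine Finset.sum_congr rfl fun j _ => ?_
  rw [mul_assoc, hφ.drinfeldElt_mul, drinfeldElt, Finset.sum_mul, Finset.mul_sum]
  simp only [mul_assoc]

end Azumaya

/-! ### Two-sided multiplications on `End(M)`. -/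

section Sandwich

variable {k M : Type*} [Field k] [AddCommGroup M] [Module k M]

theorem sandwich_tmul_eq (p q u : Module.End k M) : sandwich k M (p ⊗ₜ q) u = p * u * q := by
  ext m
  rw [sandwich_tmul]
  rfl

theorem eq_zero_of_forall_lTensor_eq_zero [FiniteDimensional k M] (w : M ⊗[k] M)
    (hw : ∀ f : M →ₗ[k] k, f.lTensor M w = 0) : w = 0 := by
  let b := Module.finBasis k M
  refine (b.tensorProduct b).ext_elem fun ij => ?_
  have h : ∀ w : M ⊗[k] M, (b.tensorProduct b).repr w ij =
      b.coord ij.1 (TensorProduct.rid k M ((b.coord ij.2).lTensor M w)) := by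
    intro w
    induction w with
    | zero => simp
    | tmul x y => rw [show ij = (ij.1, ij.2) from rfl, Module.Basis.tensorProduct_repr_tmul_apply]; simp
    | add x y hx hy => simp only [map_add, Finsupp.add_apply, hx, hy]
  rw [h, hw]
  simp

/-- Testing `u ↦ ∑ p u q` on the rank-one maps `f(·) m` gives `∑ f(q(n)) p(m)`; as `f`, `m`, `n`
vary, these recover the tensor `∑ p ⊗ q`. -/
theorem sandwich_injective [FiniteDimensional k M] : Function.Injective (sandwich k M) := by
  rw [injective_iff_map_eq_zero]
  intro z hz
  apply (homTensorHomEquiv k M M M M).injective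
  rw [map_zero, homTensorHomEquiv_apply]
  ext m n
  apply eq_zero_of_forall_lTensor_eq_zero
  intro f
  apply (TensorProduct.rid k M).injective
  have h : ∀ z : Module.End k M ⊗[k] Module.End k M,
      TensorProduct.rid k M (f.lTensor M
        (TensorProduct.homTensorHomMap (RingHom.id k) M M M M z (m ⊗ₜ n))) =
      sandwich k M z (f.smulRight m) n := by
    intro z
    induction z with
    | zero => simp
    | tmul p q => simp [sandwich_tmul]
    | add x y hx hy => simp only [map_add, LinearMap.add_apply, hx, hy]
  simp only [TensorProduct.AlgebraTensorModule.curry_apply, TensorProduct.curry_apply,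
    LinearMap.restrictScalars_self]
  rw [h, hz]
  simp

theorem bijective_of_injective_tensor_end {A : Type*} [AddCommGroup A] [Module k A]
    [FiniteDimensional k A] {f : A ⊗[k] A →ₗ[k] Module.End k A} (hf : Function.Injective f) :
    Function.Bijective f :=
  ⟨hf, (LinearMap.injective_iff_surjective_of_finrank_eq_finrank (by
    rw [Module.finrank_tensorProduct, Module.finrank_linearMap])).1 hf⟩

end Sandwich

/-! ### Injectivity of `F` and `G`. -/

section Bijectivity

variable {k H M ι : Type*} [Field k] [Ring H] [HopfAlgebra k H] [AddCommGroup M] [Module k M]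
  [Fintype ι] {hS : Function.Bijective (antipode k (A := H))} {φ : H →ₐ[k] Module.End k M}
  {e : ι → Module.End k M} {t : ι → H}

/-- The adjoint action `h · u = φ(h₁) u φ(S(h₂))` of an algebra map `φ : H → End(M)`. -/
def adjointAct (φ : H →ₐ[k] Module.End k M) : H →ₗ[k] Module.End k (Module.End k M) :=
  sandwich k M ∘ₗ TensorProduct.map φ.toLinearMap (φ.toLinearMap ∘ₗ antipode k) ∘ₗ comul

/-- The coaction `u ↦ ∑ eⱼ u eᵢ ⊗ S⁻¹(tᵢ) tⱼ`. -/
def conjCoact (hS : Function.Bijective (antipode k (A := H))) (e : ι → Module.End k M)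
    (t : ι → H) : Module.End k M →ₗ[k] Module.End k M ⊗[k] H :=
  ∑ i, ∑ j, (TensorProduct.mk k (Module.End k M) H).flip (antipodeInv hS (t i) * t j) ∘ₗ
    LinearMap.mulLeft k (e j) ∘ₗ LinearMap.mulRight k (e i)

theorem conjCoact_apply (u : Module.End k M) :
    conjCoact hS e t u = ∑ i, ∑ j, (e j * u * e i) ⊗ₜ[k] (antipodeInv hS (t i) * t j) := by
  simp [conjCoact, LinearMap.sum_apply, mul_assoc]

/-- Since `S⁻¹` reverses `Δ`, `S⁻¹(h) · u = φ(S⁻¹(h₂)) u φ(h₁)`. Splitting `Δ(tᵢ)` by the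
corepresentation rule gives `∑ eⱼ eᵢ φ(S⁻¹(tᵢ)) u φ(tⱼ)`, whose inner sum is the Drinfeld-type
element. -/
theorem IsCorep.sum_mul_adjointAct_antipodeInv (he : IsCorep k e t) (u : Module.End k M) :
    ∑ i, e i * adjointAct φ (antipodeInv hS (t i)) u =
      ∑ j, e j * drinfeldElt hS φ e t * u * φ (t j) := by
  let Λ : H ⊗[k] H →ₗ[k] Module.End k M :=
    TensorProduct.lift ((LinearMap.mul k (Module.End k M)).flip.compl₁₂ φ.toLinearMap
      (LinearMap.mulRight k u ∘ₗ φ.toLinearMap ∘ₗ antipodeInv hS))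
  have hΛ : ∀ x y, Λ (x ⊗ₜ y) = φ (antipodeInv hS y) * u * φ x := fun x y => by simp [Λ]
  have h1 : ∀ x, adjointAct φ (antipodeInv hS x) u = Λ (comul x) := by
    intro x
    rw [adjointAct, LinearMap.comp_apply, LinearMap.comp_apply, comul_antipodeInv]
    induction comul (R := k) x with
    | zero => simp
    | tmul a b =>
      rw [hΛ, TensorProduct.comm_tmul, TensorProduct.map_tmul, TensorProduct.map_tmul,
        sandwich_tmul_eq]
      simp [antipode_antipodeInv]
    | add a b ha hb => simp only [map_add, LinearMap.add_apply, ha, hb]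
  have h := congrArg (LinearMap.mul' k _ ∘ₗ Λ.lTensor (Module.End k M)) he.sum_comul
  simp only [map_sum, LinearMap.comp_apply, LinearMap.lTensor_tmul, LinearMap.mul'_apply, hΛ,
    ← h1] at h
  rw [h, Finset.sum_comm]
  refine Finset.sum_congr rfl fun j _ => ?_
  simp only [drinfeldElt, Finset.mul_sum, Finset.sum_mul, mul_assoc]

variable {D : ModComod k H (Module.End k M)}

theorem azumayaF_injective [FiniteDimensional k M] {y : Module.End k M}
    (hact : D.act = adjointAct φ) (hco : D.coact = conjCoact hS e t)
    (hmul : ∀ (g h : H) (u : Module.End k M), D.act (g * h) u = D.act g (D.act h u))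
    (hone : ∀ u : Module.End k M, D.act 1 u = u) (he : IsCorep k e t)
    (hy : y * drinfeldElt hS φ e t = 1) : Function.Injective D.azumayaF := by
  let W : Module.End k M →ₗ[k] Module.End k M :=
    ∑ i, LinearMap.mulLeft k (e i) ∘ₗ D.act (antipodeInv hS (t i))
  let W' : Module.End k M →ₗ[k] Module.End k M := LinearMap.mulLeft k y ∘ₗ
    ∑ i, LinearMap.mulLeft k (e i) ∘ₗ LinearMap.mulRight k (φ (antipodeInv hS (t i)))
  let T : Module.End k M ⊗[k] Module.End k M →ₗ[k]
      Module.End k M ⊗[k] Module.End k M :=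
    ∑ j, TensorProduct.map (LinearMap.mulRight k (e j)) (D.act (t j))
  let T' : Module.End k M ⊗[k] Module.End k M →ₗ[k]
      Module.End k M ⊗[k] Module.End k M :=
    ∑ i, TensorProduct.map (LinearMap.mulRight k (e i)) (D.act (antipodeInv hS (t i)))
  -- Expanding the coaction, `F(a ⊗ b)(c) = ∑ (a eⱼ) c (eᵢ (S⁻¹(tᵢ) · (tⱼ · b)))`: `T` collects the
  -- `j`-sum and `W` the `i`-sum.
  have hF : D.azumayaF = sandwich k M ∘ₗ W.lTensor (Module.End k M) ∘ₗ T := by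
    ext1
    ext1 a
    ext1 b
    ext1 c
    simp only [TensorProduct.AlgebraTensorModule.curry_apply, TensorProduct.curry_apply,
      LinearMap.restrictScalars_self, LinearMap.comp_apply, ModComod.azumayaF_tmul,
      ModComod.hOpMul, hco, conjCoact_apply, T, W, LinearMap.sum_apply, map_sum,
      TensorProduct.map_tmul, LinearMap.lTensor_tmul, LinearMap.mul'_apply,
      LinearMap.flip_apply, LinearMap.mulRight_apply, LinearMap.mulLeft_apply, hmul,
      sandwich_tmul_eq, TensorProduct.tmul_sum, Finset.mul_sum]
    rw [Finset.sum_comm]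
    simp only [mul_assoc]
  have hW : W' ∘ₗ W = LinearMap.id := by
    ext1 u
    have h := congrArg (LinearMap.mul' k _ ∘ₗ TensorProduct.map
      (LinearMap.mulRight k (drinfeldElt hS φ e t * u)) φ.toLinearMap)
      (he.sum_mul_tmul_mul_antipodeInv hS)
    simp only [map_sum, LinearMap.comp_apply, TensorProduct.map_tmul, LinearMap.mul'_apply,
      AlgHom.toLinearMap_apply, map_one, mul_one, map_mul, LinearMap.mulRight_apply, one_mul] at h
    -- In this form `W` is left multiplication by `X` followed by `v ↦ ∑ eⱼ v φ(tⱼ)`; `W'` undoes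
    -- the two in turn.
    have hWu : W u = ∑ j, e j * drinfeldElt hS φ e t * u * φ (t j) := by
      rw [← he.sum_mul_adjointAct_antipodeInv, ← hact]
      simp [W, LinearMap.sum_apply]
    rw [LinearMap.comp_apply, hWu]
    simp only [W', LinearMap.comp_apply, LinearMap.sum_apply, LinearMap.mulLeft_apply,
      LinearMap.mulRight_apply, LinearMap.id_apply, Finset.sum_mul, Finset.mul_sum]
    rw [Finset.sum_comm]
    have h' := congrArg (y * ·) h
    simp only [← mul_assoc, hy, one_mul, Finset.mul_sum] at h'
    refine Eq.trans ?_ h'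
    simp only [mul_assoc]
  have hT : T' ∘ₗ T = LinearMap.id := by
    ext1
    ext1 a
    ext1 b
    have h := congrArg (TensorProduct.map (LinearMap.mulLeft k a) (D.act.flip b))
      (he.sum_mul_tmul_antipodeInv_mul hS)
    simp only [map_sum, TensorProduct.map_tmul, LinearMap.mulLeft_apply, LinearMap.flip_apply,
      hmul, hone, mul_one] at h
    simp only [TensorProduct.AlgebraTensorModule.curry_apply, TensorProduct.curry_apply,
      LinearMap.restrictScalars_self, LinearMap.comp_apply, T, T', LinearMap.sum_apply, map_sum,
      TensorProduct.map_tmul, LinearMap.mulRight_apply, LinearMap.id_apply, mul_assoc]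
    rw [← h, Finset.sum_comm]
  have hT_inj : Function.Injective T :=
    LinearMap.injective_of_comp_eq_id _ _ hT
  have hW_inj : Function.Injective (W.lTensor (Module.End k M)) := by
    refine LinearMap.injective_of_comp_eq_id _ (W'.lTensor (Module.End k M)) ?_
    rw [← LinearMap.lTensor_comp, hW, LinearMap.lTensor_id]
  rw [hF]
  exact sandwich_injective.comp (hW_inj.comp hT_inj)

theorem azumayaG_injective [FiniteDimensional k M] {y : Module.End k M}
    (hact : D.act = adjointAct φ) (hco : D.coact = conjCoact hS e t)
    (hmul : ∀ (g h : H) (u : Module.End k M), D.act (g * h) u = D.act g (D.act h u))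
    (he : IsCorep k e t)
    (hy : drinfeldElt hS φ e t * y = 1) : Function.Injective D.azumayaG := by
  let X := drinfeldElt hS φ e t
  let T : Module.End k M ⊗[k] Module.End k M →ₗ[k]
      Module.End k M ⊗[k] Module.End k M :=
    ∑ i, TensorProduct.map (LinearMap.mulRight k (e i)) (LinearMap.mulLeft k (φ (t i)))
  let T' : Module.End k M ⊗[k] Module.End k M →ₗ[k]
      Module.End k M ⊗[k] Module.End k M :=
    ∑ i, TensorProduct.map (LinearMap.mulRight k (e i))
      (LinearMap.mulLeft k (φ (antipodeInv hS (t i))))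
  let U : Module.End k M ⊗[k] Module.End k M →ₗ[k]
      Module.End k M ⊗[k] Module.End k M :=
    ∑ j, TensorProduct.map (LinearMap.mulLeft k (e j)) (LinearMap.mulLeft k (φ (antipode k (t j))))
  let U' : Module.End k M ⊗[k] Module.End k M →ₗ[k]
      Module.End k M ⊗[k] Module.End k M :=
    ∑ j, TensorProduct.map (LinearMap.mulLeft k (e j)) (LinearMap.mulLeft k (φ (t j)))
  let V : Module.End k M →ₗ[k] Module.End k M :=
    ∑ j, LinearMap.mulLeft k (e j) ∘ₗ LinearMap.mulRight k (φ (t j))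
  let V' : Module.End k M →ₗ[k] Module.End k M :=
    ∑ i, LinearMap.mulLeft k (e i) ∘ₗ LinearMap.mulRight k (φ (antipodeInv hS (t i)))
  -- Expanding everything, `G(a ⊗ b)(c)` is the sum of `eⱼ' eⱼ a eᵢ X φ(tⱼ') c φ(S(tⱼ)) φ(tᵢ) b`.
  -- The indices `i`, `j`, `j'` belong to `T`, `U`, `V` respectively.
  have hG : D.azumayaG = sandwich k M ∘ₗ V.rTensor (Module.End k M) ∘ₗ U ∘ₗ
      (LinearMap.mulRight k X).rTensor (Module.End k M) ∘ₗ T := by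
    ext1
    ext1 a
    ext1 b
    ext1 c
    have h1 : D.azumayaG (a ⊗ₜ b) c = ∑ j, e j * a *
        (∑ i, e i * adjointAct φ (antipodeInv hS (t i)) (D.act (t j) c)) * b := by
      simp only [ModComod.azumayaG_tmul, ModComod.hOpMul, hco, conjCoact_apply, map_sum,
        LinearMap.lTensor_tmul, LinearMap.mul'_apply, LinearMap.flip_apply, hmul,
        Finset.mul_sum, Finset.sum_mul, ← hact]
      rw [Finset.sum_comm]
      simp only [mul_assoc]
    -- The adjoint action of `tⱼ` involves `Δ(tⱼ)`, which the corepresentation rule splits into two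
    -- indices.
    have h2 : ∀ i, ∑ j, e j * a * (e i * X * D.act (t j) c * φ (t i)) * b =
        ∑ j, ∑ j', e j' * e j * a * e i * X * φ (t j') * c * φ (antipode k (t j)) * φ (t i) * b := by
      intro i
      have h := congrArg (LinearMap.mul' k _ ∘ₗ TensorProduct.map
        (LinearMap.mulRight k (a * (e i * X))) (LinearMap.mulRight k (φ (t i) * b) ∘ₗ
          LinearMap.applyₗ c ∘ₗ sandwich k M ∘ₗ
          TensorProduct.map φ.toLinearMap (φ.toLinearMap ∘ₗ antipode k))) he.sum_comul
      simp only [map_sum, LinearMap.comp_apply, TensorProduct.map_tmul, LinearMap.mul'_apply,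
        LinearMap.mulRight_apply, sandwich_tmul_eq, LinearMap.applyₗ_apply_apply,
        AlgHom.toLinearMap_apply] at h
      simp only [hact, adjointAct, LinearMap.comp_apply]
      simp only [mul_assoc] at h ⊢
      exact h
    simp only [TensorProduct.AlgebraTensorModule.curry_apply, TensorProduct.curry_apply,
      LinearMap.restrictScalars_self]
    rw [h1]
    simp only [he.sum_mul_adjointAct_antipodeInv, Finset.mul_sum, Finset.sum_mul]
    rw [Finset.sum_comm]
    simp only [X] at h2
    simp only [h2]
    simp only [LinearMap.comp_apply, T, U, V, X, LinearMap.sum_apply, map_sum,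
      TensorProduct.map_tmul, LinearMap.rTensor_tmul, LinearMap.mulRight_apply,
      LinearMap.mulLeft_apply, sandwich_tmul_eq, TensorProduct.sum_tmul, mul_assoc]
  have hT : T' ∘ₗ T = LinearMap.id := by
    ext1
    ext1 a
    ext1 b
    have h := congrArg (TensorProduct.map (LinearMap.mulLeft k a)
      (LinearMap.mulRight k b ∘ₗ φ.toLinearMap)) (he.sum_mul_tmul_antipodeInv_mul hS)
    simp only [map_sum, TensorProduct.map_tmul, LinearMap.mulLeft_apply, LinearMap.mulRight_apply,
      LinearMap.comp_apply, AlgHom.toLinearMap_apply, map_mul, map_one, one_mul, mul_one] at h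
    simp only [TensorProduct.AlgebraTensorModule.curry_apply, TensorProduct.curry_apply,
      LinearMap.restrictScalars_self, LinearMap.comp_apply, T, T', LinearMap.sum_apply, map_sum,
      TensorProduct.map_tmul, LinearMap.mulRight_apply, LinearMap.mulLeft_apply,
      LinearMap.id_apply, mul_assoc]
    rw [← h, Finset.sum_comm]
    simp only [mul_assoc]
  have hU : U' ∘ₗ U = LinearMap.id := by
    ext1
    ext1 a
    ext1 b
    have h := congrArg (TensorProduct.map (LinearMap.mulRight k a)
      (LinearMap.mulRight k b ∘ₗ φ.toLinearMap)) he.sum_mul_tmul_mul_antipode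
    simp only [map_sum, TensorProduct.map_tmul, LinearMap.mulRight_apply,
      LinearMap.comp_apply, AlgHom.toLinearMap_apply, map_mul, map_one, one_mul, mul_assoc] at h
    simp only [TensorProduct.AlgebraTensorModule.curry_apply, TensorProduct.curry_apply,
      LinearMap.restrictScalars_self, LinearMap.comp_apply, U, U', LinearMap.sum_apply, map_sum,
      TensorProduct.map_tmul, LinearMap.mulLeft_apply, LinearMap.id_apply]
    exact h
  have hV : V' ∘ₗ V = LinearMap.id := by
    ext1 u
    have h := congrArg (LinearMap.mul' k _ ∘ₗ TensorProduct.map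
      (LinearMap.mulRight k u) φ.toLinearMap) (he.sum_mul_tmul_mul_antipodeInv hS)
    simp only [map_sum, LinearMap.comp_apply, TensorProduct.map_tmul, LinearMap.mul'_apply,
      AlgHom.toLinearMap_apply, map_one, mul_one, map_mul, LinearMap.mulRight_apply, one_mul,
      mul_assoc] at h
    simp only [V, V', LinearMap.comp_apply, LinearMap.sum_apply, LinearMap.mulLeft_apply,
      LinearMap.mulRight_apply, LinearMap.id_apply, map_sum, mul_assoc]
    exact h
  have hX : LinearMap.mulRight k y ∘ₗ LinearMap.mulRight k X = LinearMap.id := by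
    ext1 u
    simp [X, mul_assoc, hy]
  have rTensor_inj : ∀ f g : Module.End k M →ₗ[k] Module.End k M, g ∘ₗ f = LinearMap.id →
      Function.Injective (f.rTensor (Module.End k M)) := fun f g hfg => by
    refine LinearMap.injective_of_comp_eq_id _ (g.rTensor (Module.End k M)) ?_
    rw [← LinearMap.rTensor_comp, hfg, LinearMap.rTensor_id]
  rw [hG]
  exact sandwich_injective.comp ((rTensor_inj V V' hV).comp
    ((LinearMap.injective_of_comp_eq_id _ _ hU).comp
      ((rTensor_inj _ _ hX).comp (LinearMap.injective_of_comp_eq_id _ _ hT))))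

end Bijectivity

/-! ### The adjoint action makes `End(M)` a module algebra. -/

section AdjointAction

variable {k H M ι : Type*} [Field k] [Ring H] [HopfAlgebra k H] [AddCommGroup M] [Module k M]
  [Fintype ι] {hS : Function.Bijective (antipode k (A := H))} {φ : H →ₐ[k] Module.End k M}
  {e : ι → Module.End k M} {t : ι → H}

theorem adjointAct_one (u : Module.End k M) : adjointAct φ 1 u = u := by
  rw [adjointAct, LinearMap.comp_apply, LinearMap.comp_apply, Bialgebra.comul_one,
    Algebra.TensorProduct.one_def, TensorProduct.map_tmul, sandwich_tmul_eq]
  simp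

theorem adjointAct_mul (g h : H) (u : Module.End k M) :
    adjointAct φ (g * h) u = adjointAct φ g (adjointAct φ h u) := by
  simp only [adjointAct, LinearMap.comp_apply, Bialgebra.comul_mul]
  induction comul (R := k) g with
  | zero => simp
  | tmul a b =>
    induction comul (R := k) h with
    | zero => simp
    | tmul c d =>
      simp only [Algebra.TensorProduct.tmul_mul_tmul, TensorProduct.map_tmul, sandwich_tmul_eq,
        LinearMap.comp_apply, AlgHom.toLinearMap_apply, antipode_mul_antidistrib, map_mul,
        mul_assoc]
    | add x y hx hy => simp only [mul_add, map_add, LinearMap.add_apply, hx, hy]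
  | add x y hx hy => simp only [add_mul, map_add, LinearMap.add_apply, hx, hy]

theorem convMapHom_conj_apply (u : Module.End k M) (h : H) :
    (convMapHom φ (WithConv.toConv LinearMap.id) * convConst u *
      convMapHom φ (WithConv.toConv (antipode k)) : WithConv (H →ₗ[k] Module.End k M)) h =
      adjointAct φ h u := by
  rw [LinearMap.convMul_apply, adjointAct, LinearMap.comp_apply, LinearMap.comp_apply]
  induction comul (R := k) h with
  | zero => simp
  | tmul x y =>
    rw [TensorProduct.map_tmul, TensorProduct.map_tmul, LinearMap.mul'_apply, mul_convConst_apply,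
      sandwich_tmul_eq]
    rfl
  | add x y hx hy => simp only [map_add, LinearMap.add_apply, hx, hy]

theorem adjointAct_apply_one (h : H) :
    adjointAct φ h 1 = counit (R := k) h • (1 : Module.End k M) := by
  rw [← convMapHom_conj_apply, convConst_one, mul_one, convMapHom_mul_antipode,
    LinearMap.convOne_apply, Algebra.algebraMap_eq_smul_one]

/-- The action on `u` is the convolution conjugate `φ u φ⁻¹`, and conjugation is multiplicative. -/
theorem adjointAct_apply_mul (h : H) (u v : Module.End k M) :
    adjointAct φ h (u * v) = LinearMap.mul' k _
      (TensorProduct.map ((adjointAct φ).flip u) ((adjointAct φ).flip v) (comul h)) := by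
  have hf : ∀ w : Module.End k M, WithConv.toConv ((adjointAct φ).flip w) =
      (convMapHom φ (WithConv.toConv LinearMap.id) * convConst w *
      convMapHom φ (WithConv.toConv (antipode k)) : WithConv (H →ₗ[k] Module.End k M)) := by
    intro w
    ext1
    ext1 x
    exact (convMapHom_conj_apply w x).symm
  have h1 : WithConv.toConv ((adjointAct φ).flip (u * v)) =
      WithConv.toConv ((adjointAct φ).flip u) * WithConv.toConv ((adjointAct φ).flip v) := by
    have h2 := convMapHom_antipode_mul φ
    rw [hf, hf, hf, convConst_mul]
    simp only [mul_assoc]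
    rw [← mul_assoc (convMapHom φ (WithConv.toConv (antipode k))), h2, one_mul]
  exact LinearMap.congr_fun (congrArg WithConv.ofConv h1) h

theorem convLeft_conj_apply (w : Module.End k M ⊗[k] Hᵐᵒᵖ) (h : H) :
    (convLeft φ.toLinearMap * convConst w * convLeft (φ.toLinearMap ∘ₗ antipode k) :
      WithConv (H →ₗ[k] Module.End k M ⊗[k] Hᵐᵒᵖ)) h = (adjointAct φ h).rTensor _ w := by
  rw [LinearMap.convMul_apply, adjointAct, LinearMap.comp_apply, LinearMap.comp_apply]
  induction comul (R := k) h with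
  | zero => simp
  | tmul a b =>
    rw [TensorProduct.map_tmul, TensorProduct.map_tmul, LinearMap.mul'_apply, mul_convConst_apply,
      convLeft_apply, convLeft_apply]
    induction w with
    | zero => simp
    | tmul u x =>
      rw [LinearMap.rTensor_tmul, sandwich_tmul_eq, Algebra.TensorProduct.tmul_mul_tmul,
        Algebra.TensorProduct.tmul_mul_tmul, one_mul, mul_one]
    | add x y hx hy => simp only [map_add, mul_add, add_mul, hx, hy]
  | add a b ha hb => simp only [map_add, LinearMap.rTensor_add, LinearMap.add_apply, ha, hb]

end AdjointAction

/-! ### The conjugation coaction makes `End(M)` a comodule algebra. -/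

section ConjCoaction

variable {k H M ι : Type*} [Field k] [Ring H] [HopfAlgebra k H] [AddCommGroup M] [Module k M]
  [Fintype ι] {hS : Function.Bijective (antipode k (A := H))} {φ : H →ₐ[k] Module.End k M}
  {e : ι → Module.End k M} {t : ι → H}

theorem lTensor_op_conjCoact (u : Module.End k M) :
    (MulOpposite.opLinearEquiv k (M := H)).toLinearMap.lTensor _ (conjCoact hS e t u) =
      corepElt k e t * (u ⊗ₜ 1) * corepElt k e fun i => antipodeInv hS (t i) := by
  simp only [conjCoact_apply, map_sum, LinearMap.lTensor_tmul, corepElt, Finset.sum_mul,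
    Finset.mul_sum, Algebra.TensorProduct.tmul_mul_tmul, mul_one, LinearEquiv.coe_coe,
    MulOpposite.coe_opLinearEquiv, MulOpposite.op_mul]

theorem lTensor_op_injective (A H : Type*) [AddCommGroup A] [Module k A] [AddCommGroup H]
    [Module k H] :
    Function.Injective ((MulOpposite.opLinearEquiv k (M := H)).toLinearMap.lTensor A) :=
  ((MulOpposite.opLinearEquiv k (M := H)).lTensor A).injective

theorem IsCorep.conjCoact_one (he : IsCorep k e t) : conjCoact hS e t 1 = 1 ⊗ₜ 1 := by
  simpa only [conjCoact_apply, mul_one] using he.sum_mul_tmul_antipodeInv_mul hS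

theorem IsCorep.lTensor_op_conjCoact_mul (he : IsCorep k e t) (u v : Module.End k M) :
    (MulOpposite.opLinearEquiv k (M := H)).toLinearMap.lTensor _ (conjCoact hS e t (u * v)) =
      (MulOpposite.opLinearEquiv k (M := H)).toLinearMap.lTensor _ (conjCoact hS e t u) *
        (MulOpposite.opLinearEquiv k (M := H)).toLinearMap.lTensor _ (conjCoact hS e t v) := by
  have h : (corepElt k e fun i => antipodeInv hS (t i)) * corepElt k e t = 1 :=
    (he.unit hS).inv_mul
  have h2 : (u * v) ⊗ₜ[k] (1 : Hᵐᵒᵖ) = (u ⊗ₜ 1) * (v ⊗ₜ 1) := by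
    rw [Algebra.TensorProduct.tmul_mul_tmul, one_mul]
  rw [lTensor_op_conjCoact, lTensor_op_conjCoact, lTensor_op_conjCoact, h2]
  simp only [mul_assoc]
  rw [← mul_assoc (corepElt k e fun i => antipodeInv hS (t i)), h, one_mul]

theorem IsCorep.conjCoact_counit (he : IsCorep k e t) (u : Module.End k M) :
    TensorProduct.rid k _ ((counit (R := k) (A := H)).lTensor _ (conjCoact hS e t u)) = u := by
  simp only [conjCoact_apply, map_sum, LinearMap.lTensor_tmul, TensorProduct.rid_tmul,
    Bialgebra.counit_mul, counit_antipodeInv]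
  calc _ = (∑ j, counit (R := k) (t j) • e j) * u * ∑ i, counit (R := k) (t i) • e i := by
        simp only [Finset.sum_mul, Finset.mul_sum, smul_mul_assoc, mul_smul_comm, smul_smul,
          Finset.smul_sum]
    _ = u := by rw [he.sum_counit, one_mul, mul_one]

/-- Apply the corepresentation rule to `tⱼ` and to `tᵢ` in `Δ(S⁻¹(tᵢ) tⱼ)`. Because `S⁻¹` flips `Δ`,
the new factors to the right of `u` come out in the nesting order of the iterated coaction. -/
theorem IsCorep.conjCoact_coassoc (he : IsCorep k e t) (u : Module.End k M) :
    TensorProduct.assoc k _ H H ((conjCoact hS e t).rTensor H (conjCoact hS e t u)) =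
      (comul (R := k) (A := H)).lTensor _ (conjCoact hS e t u) := by
  have h1 : ∀ (p : Module.End k M) (x : H), ∑ j, (e j * p) ⊗ₜ[k] comul (R := k) (x * t j) =
      ∑ j, ∑ j', (e j' * e j * p) ⊗ₜ[k] (comul (R := k) x * (t j' ⊗ₜ t j)) := by
    intro p x
    have h := congrArg (TensorProduct.map (LinearMap.mulRight k p)
      (LinearMap.mulLeft k (comul (R := k) x))) he.sum_comul
    simpa only [map_sum, TensorProduct.map_tmul, LinearMap.mulRight_apply,
      LinearMap.mulLeft_apply, ← Bialgebra.comul_mul] using h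
  have h2 : ∀ (p : Module.End k M) (x y : H), ∑ i, (p * e i) ⊗ₜ[k]
      (comul (R := k) (antipodeInv hS (t i)) * (x ⊗ₜ[k] y)) =
      ∑ i, ∑ i', (p * (e i' * e i)) ⊗ₜ[k]
        ((antipodeInv hS (t i) * x) ⊗ₜ[k] (antipodeInv hS (t i') * y)) := by
    intro p x y
    have h := congrArg (TensorProduct.map (LinearMap.mulLeft k p)
      (LinearMap.mulRight k (x ⊗ₜ[k] y) ∘ₗ TensorProduct.map (antipodeInv hS) (antipodeInv hS) ∘ₗ
        (TensorProduct.comm k H H).toLinearMap)) he.sum_comul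
    simpa only [map_sum, TensorProduct.map_tmul, LinearMap.mulRight_apply,
      LinearMap.mulLeft_apply, LinearMap.comp_apply, LinearEquiv.coe_coe,
      ← comul_antipodeInv, TensorProduct.comm_tmul, Algebra.TensorProduct.tmul_mul_tmul] using h
  have h3 : ∀ i, ∑ j, (e j * u * e i) ⊗ₜ[k] comul (R := k) (antipodeInv hS (t i) * t j) =
      ∑ j, ∑ j', (e j' * e j * u * e i) ⊗ₜ[k]
        (comul (R := k) (antipodeInv hS (t i)) * (t j' ⊗ₜ t j)) := by
    intro i
    simpa only [mul_assoc] using h1 (u * e i) (antipodeInv hS (t i))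
  simp only [conjCoact_apply, map_sum, LinearMap.lTensor_tmul, LinearMap.rTensor_tmul,
    TensorProduct.sum_tmul, TensorProduct.assoc_tmul]
  simp only [h3]
  have h4 : ∑ i, ∑ j, ∑ j', (e j' * e j * u * e i) ⊗ₜ[k]
        (comul (R := k) (antipodeInv hS (t i)) * (t j' ⊗ₜ t j)) =
      ∑ j, ∑ j', ∑ i, (e j' * e j * u * e i) ⊗ₜ[k]
        (comul (R := k) (antipodeInv hS (t i)) * (t j' ⊗ₜ t j)) := by
    rw [Finset.sum_comm]
    exact Finset.sum_congr rfl fun _ _ => Finset.sum_comm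
  rw [h4]
  simp only [h2]
  have h5 : ∀ f : ι → ι → ι → ι → Module.End k M ⊗[k] (H ⊗[k] H),
      ∑ i, ∑ j, ∑ i', ∑ j', f i j i' j' = ∑ j, ∑ j', ∑ i', ∑ i, f i j i' j' := by
    intro f
    rw [Finset.sum_comm]
    refine Finset.sum_congr rfl fun j _ => ?_
    rw [Finset.sum_comm]
    exact (Finset.sum_congr rfl fun _ _ => Finset.sum_comm).trans Finset.sum_comm
  rw [h5]
  simp only [mul_assoc]

end ConjCoaction

/-! ### The Yetter-Drinfeld condition on `End(M)`. -/

section Compatibility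

variable {k H M ι : Type*} [Field k] [Ring H] [HopfAlgebra k H] [AddCommGroup M] [Module k M]
  [Fintype ι] {hS : Function.Bijective (antipode k (A := H))} {φ : H →ₐ[k] Module.End k M}
  {e : ι → Module.End k M} {t : ι → H}

theorem IsYDPair.conjCoact_adjointAct {β : H ≃ₐc[k] H} (hφ : IsYDPair hS β φ e t)
    (he : IsCorep k e t) {D : ModComod k H (Module.End k M)} (hD : D.act = adjointAct φ)
    (h : H) (u : Module.End k M) :
    conjCoact hS e t (adjointAct φ h u) =
      ydTwist hS (BialgEquiv.refl k H) (BialgEquiv.refl k H) D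
        ((comul (R := k) (A := H)).lTensor H (comul h)) (conjCoact hS e t u) := by
  have key := LinearMap.congr_fun (congrArg WithConv.ofConv (hφ.conj he u)) h
  rw [mul_convConst_apply, convConst_mul_apply, convLeft_conj_apply, LinearMap.rTensor_tmul,
    ← lTensor_op_conjCoact, ← lTensor_op_conjCoact] at key
  apply lTensor_op_injective
  rw [key]
  rw [convMul_convMul_apply]
  generalize (comul (R := k) (A := H)).lTensor H (comul h) = z
  induction z with
  | zero => simp
  | add x y hx hy => simp only [map_add, LinearMap.add_apply, hx, hy]
  | tmul a z =>
    induction z with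
    | zero => simp
    | add x y hx hy => simp only [map_add, LinearMap.add_apply, hx, hy, TensorProduct.tmul_add]
    | tmul b c =>
      rw [TensorProduct.map_tmul, LinearMap.comp_apply, TensorProduct.map_tmul,
        LinearMap.mul'_apply, LinearMap.mul'_apply, convLeft_conj_apply]
      induction conjCoact hS e t u with
      | zero => simp
      | add x y hx hy => simp only [map_add, mul_add, add_mul, hx, hy]
      | tmul p x =>
        rw [LinearMap.lTensor_tmul, LinearMap.rTensor_tmul, ydTwist_tmul, hD]
        simp [mul_assoc]

end Compatibility

/-! ### Passage from a module and comodule to `φ` and `∑ eᵢ ⊗ tᵢ`. -/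

section Coefficients

variable {k H M : Type*} [Field k] [Ring H] [HopfAlgebra k H] [AddCommGroup M] [Module k M]

/-- The algebra map `H → End(M)` of an action. -/
def ModComod.IsModComod.actHom {D : ModComod k H M} (hD : D.IsModComod) :
    H →ₐ[k] Module.End k M :=
  AlgHom.ofLinearMap D.act (LinearMap.ext hD.one_act) fun g h => LinearMap.ext (hD.mul_act g h)

/-- Finite-dimensionality gives `Hom(M, M ⊗ H) ≃ End(M) ⊗ H`. Any presentation of the tensor as a
finite sum will do; no basis of `M` is needed. -/
theorem exists_coact_eq_sum [FiniteDimensional k M] (δ : M →ₗ[k] M ⊗[k] H) :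
    ∃ S : Finset (Module.End k M × H), ∀ m, δ m = ∑ i : S, i.1.1 m ⊗ₜ i.1.2 := by
  obtain ⟨S, hS⟩ := TensorProduct.exists_finset ((rTensorHomEquivHomRTensor k M M H).symm δ)
  refine ⟨S, fun m => ?_⟩
  have h := (rTensorHomEquivHomRTensor k M M H).apply_symm_apply δ
  rw [hS] at h
  rw [← h, Finset.sum_coe_sort S (fun i => i.1 m ⊗ₜ[k] i.2)]
  simp [LinearMap.sum_apply]

variable {ι : Type*} [Fintype ι] {e : ι → Module.End k M} {t : ι → H} {D : ModComod k H M}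

theorem ModComod.IsModComod.isCorep [FiniteDimensional k M] (hD : D.IsModComod)
    (hc : ∀ m, D.coact m = ∑ i, e i m ⊗ₜ t i) : IsCorep k e t where
  sum_comul := by
    apply (rTensorHomEquivHomRTensor k M M (H ⊗[k] H)).injective
    ext1 m
    have h := hD.coact_coassoc m
    simp only [hc, map_sum, LinearMap.rTensor_tmul, LinearMap.lTensor_tmul, TensorProduct.sum_tmul,
      TensorProduct.assoc_tmul] at h
    simpa [LinearMap.sum_apply] using h.symm
  sum_counit := by
    ext1 m
    have h := hD.coact_counit m
    simp only [hc, map_sum, LinearMap.lTensor_tmul, TensorProduct.rid_tmul] at h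
    simpa [LinearMap.sum_apply] using h

theorem ModComod.IsYetterDrinfeld.isYDPair [FiniteDimensional k M]
    {hS : Function.Bijective (antipode k (A := H))} {β : H ≃ₐc[k] H}
    (hD : D.IsYetterDrinfeld hS (BialgEquiv.refl k H) β)
    (hc : ∀ m, D.coact m = ∑ i, e i m ⊗ₜ t i) :
    IsYDPair hS β hD.toIsModComod.actHom e t := by
  unfold IsYDPair
  ext1
  ext1 h
  change (_ * _ : WithConv (H →ₗ[k] Module.End k M ⊗[k] Hᵐᵒᵖ)) h =
    (_ * _ : WithConv (H →ₗ[k] Module.End k M ⊗[k] Hᵐᵒᵖ)) h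
  apply (rTensorHomEquivHomRTensor k M M Hᵐᵒᵖ).injective
  ext1 m
  rw [convMul_convMul_apply, convConst_mul_apply]
  have key := congrArg ((MulOpposite.opLinearEquiv k (M := H)).toLinearMap.lTensor M)
    (hD.compat h m)
  have h1 : ∀ z : H ⊗[k] (H ⊗[k] H),
      (MulOpposite.opLinearEquiv k (M := H)).toLinearMap.lTensor M
        (ydTwist hS (BialgEquiv.refl k H) β D z (D.coact m)) =
      rTensorHomEquivHomRTensor k M M Hᵐᵒᵖ (LinearMap.mul' k _ (TensorProduct.map
        (convOp (Module.End k M) (antipodeInv hS)).ofConv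
        (LinearMap.mul' k _ ∘ₗ TensorProduct.map
          (convLeft hD.toIsModComod.actHom.toLinearMap).ofConv
          (convConst (corepElt k e t) * convOp (Module.End k M) β.toAlgEquiv.toLinearMap :
            WithConv (H →ₗ[k] Module.End k M ⊗[k] Hᵐᵒᵖ)).ofConv) z)) m := by
    intro z
    induction z with
    | zero => simp
    | add x y hx hy => simp only [map_add, LinearMap.add_apply, hx, hy]
    | tmul a z =>
      induction z with
      | zero => simp
      | add x y hx hy => simp only [map_add, LinearMap.add_apply, hx, hy, TensorProduct.tmul_add]
      | tmul b c =>
        rw [TensorProduct.map_tmul, LinearMap.comp_apply, TensorProduct.map_tmul,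
          LinearMap.mul'_apply, LinearMap.mul'_apply, convConst_mul_apply, hc]
        simp [ydTwist_tmul, corepElt, Finset.mul_sum, Finset.sum_mul, LinearMap.sum_apply,
          ModComod.IsModComod.actHom, mul_assoc]
  refine Eq.trans ?_ (h1 _)
  rw [← key, hc]
  simp [corepElt, Finset.sum_mul, LinearMap.sum_apply, ModComod.IsModComod.actHom]

theorem endModComod_coact_eq [FiniteDimensional k M]
    (hS : Function.Bijective (antipode k (A := H))) (α : H ≃ₐc[k] H)
    (hc : ∀ m, D.coact m = ∑ i, e i m ⊗ₜ t i) :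
    (endModComod hS α D).coact = conjCoact hS e t := by
  ext1 u
  apply (rTensorHomEquivHomRTensor k M M H).injective
  ext1 m
  rw [rTensorHomEquivHomRTensor_apply, endModComod_coact_apply]
  simp [hc, conjCoact_apply, LinearMap.sum_apply, mulAntipodeInv_tmul, TensorProduct.sum_tmul]

theorem endModComod_act_eq [FiniteDimensional k M]
    (hS : Function.Bijective (antipode k (A := H))) (hD : D.IsModComod) :
    (endModComod hS (BialgEquiv.refl k H) D).act = adjointAct hD.actHom :=
  rfl

end Coefficients

/-! ### The case `α = id` and the reduction to it. -/

section Main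

variable {k H M : Type*} [Field k] [Ring H] [HopfAlgebra k H] [AddCommGroup M] [Module k M]

theorem isHAzumaya_endModComod_refl [FiniteDimensional k M]
    {hS : Function.Bijective (antipode k (A := H))} {β : H ≃ₐc[k] H} {D : ModComod k H M} (hD : D.IsYetterDrinfeld hS (BialgEquiv.refl k H) β) :
    (endModComod hS (BialgEquiv.refl k H) D).IsHAzumaya hS := by
  obtain ⟨S, hc⟩ := exists_coact_eq_sum D.coact
  have he := hD.toIsModComod.isCorep hc
  have hφ := hD.isYDPair hc
  have hact := endModComod_act_eq hS hD.toIsModComod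
  have hco := endModComod_coact_eq hS (BialgEquiv.refl k H) hc
  obtain ⟨y, hy⟩ := hφ.exists_mul_drinfeldElt_eq_one he
  have hmul : ∀ (g h : H) (u : Module.End k M),
      (endModComod hS (BialgEquiv.refl k H) D).act (g * h) u =
      (endModComod hS (BialgEquiv.refl k H) D).act g
        ((endModComod hS (BialgEquiv.refl k H) D).act h u) := by
    rw [hact]; exact adjointAct_mul
  have hone : ∀ u : Module.End k M, (endModComod hS (BialgEquiv.refl k H) D).act 1 u = u := by
    rw [hact]; exact adjointAct_one
  exact
    { finiteDimensional := inferInstance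
      isYDAlgebra :=
        { one_act := hone
          mul_act := hmul
          coact_coassoc := by rw [hco]; exact he.conjCoact_coassoc
          coact_counit := by rw [hco]; exact he.conjCoact_counit
          compat := fun h u => by
            rw [hco]
            exact hφ.conjCoact_adjointAct he hact h u
          act_mul := by rw [hact]; exact adjointAct_apply_mul
          act_one := by rw [hact]; exact adjointAct_apply_one
          coact_mul := by rw [hco]; exact he.lTensor_op_conjCoact_mul
          coact_one := by rw [hco]; exact he.conjCoact_one }
      bijective_F := bijective_of_injective_tensor_end
        (azumayaF_injective hact hco hmul hone he hy)
      -- `G` needs a right inverse of `X`; in `End(M)` with `M` finite-dimensional, the left inverse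
      -- `y` is one.
      bijective_G := bijective_of_injective_tensor_end
        (azumayaG_injective hact hco hmul he (mul_eq_one_comm.1 hy)) }

/-- The action of `D` twisted by an automorphism of `H`. -/
def ModComod.twistAct (D : ModComod k H M) (α : H ≃ₐc[k] H) : ModComod k H M where
  act := D.act ∘ₗ α.symm.toAlgEquiv.toLinearMap
  coact := D.coact

/-- Put `α⁻¹(h)` for `h` in the compatibility: `α⁻¹` commutes with `Δ` and `α` with `S⁻¹`, so the
right-hand factor becomes `S⁻¹(h₁)` and the left-hand one `β(α⁻¹(h₃))`. -/
theorem ModComod.IsYetterDrinfeld.twistAct {hS : Function.Bijective (antipode k (A := H))}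
    {α β : H ≃ₐc[k] H} {D : ModComod k H M} (hD : D.IsYetterDrinfeld hS α β) :
    (D.twistAct α).IsYetterDrinfeld hS (BialgEquiv.refl k H) (α.symm.trans β) where
  one_act m := by
    change D.act (α.symm 1) m = m
    rw [map_one, hD.one_act]
  mul_act g h m := by
    change D.act (α.symm (g * h)) m = D.act (α.symm g) (D.act (α.symm h) m)
    rw [map_mul, hD.mul_act]
  coact_coassoc := hD.coact_coassoc
  coact_counit := hD.coact_counit
  compat h m := by
    have hα : ∀ x, comul (R := k) (α.symm x) =
        TensorProduct.map α.symm.toAlgEquiv.toLinearMap α.symm.toAlgEquiv.toLinearMap (comul x) :=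
      fun x => (CoalgHomClass.map_comp_comul_apply α.symm x).symm
    change D.coact (D.act (α.symm h) m) = ydTwist hS _ _ _ _ (D.coact m)
    rw [hD.compat, hα]
    have h1 : ∀ z : H ⊗[k] H, (comul (R := k) (A := H)).lTensor H (TensorProduct.map
        α.symm.toAlgEquiv.toLinearMap α.symm.toAlgEquiv.toLinearMap z) =
        TensorProduct.map α.symm.toAlgEquiv.toLinearMap (TensorProduct.map
          α.symm.toAlgEquiv.toLinearMap α.symm.toAlgEquiv.toLinearMap)
          ((comul (R := k) (A := H)).lTensor H z) := by
      intro z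
      induction z with
      | zero => simp
      | add x y hx hy => simp only [map_add, hx, hy]
      | tmul a b =>
        simp only [TensorProduct.map_tmul, LinearMap.lTensor_tmul]
        exact congrArg _ (hα b)
    rw [h1]
    generalize D.coact m = w
    induction (comul (R := k) (A := H)).lTensor H (comul h) with
    | zero => simp
    | add x y hx hy => simp only [map_add, LinearMap.add_apply, hx, hy]
    | tmul a z =>
      induction z with
      | zero => simp
      | add x y hx hy => simp only [map_add, LinearMap.add_apply, hx, hy, TensorProduct.tmul_add]
      | tmul b c =>
        induction w with
        | zero => simp
        | add x y hx hy => simp only [map_add, hx, hy]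
        | tmul p x =>
          rw [TensorProduct.map_tmul, TensorProduct.map_tmul, ydTwist_tmul, ydTwist_tmul,
            map_antipodeInv_of_bialgEquiv]
          have hαa : α (α.symm.toAlgEquiv.toLinearMap a) = a := α.apply_symm_apply a
          rw [hαa]
          rfl

/-- Definitional: the coaction on `End(M)` does not involve `α`, and the action uses `α` only
through `α⁻¹` followed by the action on `M`. -/
theorem endModComod_eq_twistAct [FiniteDimensional k M]
    (hS : Function.Bijective (antipode k (A := H))) (α : H ≃ₐc[k] H)
    (D : ModComod k H M) :
    endModComod hS α D = endModComod hS (BialgEquiv.refl k H) (D.twistAct α) := by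
  rfl

end Main

end GenYD

end

theorem mainTheorem1 {k H M : Type*} [Field k] [Ring H] [HopfAlgebra k H]
    (hS : Function.Bijective (HopfAlgebra.antipode k (A := H)))
    (α β : H ≃ₐc[k] H)
    [AddCommGroup M] [Module k M] [FiniteDimensional k M]
    (D : GenYD.ModComod k H M) (hD : D.IsYetterDrinfeld hS α β) :
    (GenYD.endModComod hS α D).IsHAzumaya hS := by
  rw [GenYD.endModComod_eq_twistAct]
  exact GenYD.isHAzumaya_endModComod_refl hD.twistAct
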